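/- Let $Q_1(x)=\operatorname{sech}(x)$ and $\mathbf{\Psi}_1(x)=\operatorname{sech}(x)\,\bigl(-e^{-x/2},\,e^{x/2}\bigr)^{T}$, $x\in\mathbb{R}$. There exist constants $C>0$ and $\varepsilon>0$ such that for every $Q\in L^2(\mathbb{R};\mathbb{C})$ with $\|Q-Q_1\|_{L^2}\le\varepsilon$ there exist $k,v\in\mathbb{R}$ (depending on $Q$) such that, with $\eta=(k+iv)/2$, the following hold. 1. The spectral problem $$\partial_x\Psi=\begin{pmatrix}\eta & Q\\ -\overline{Q} & -\eta\end{pmatrix}\Psi \qquad(\ast)$$ has a nonzero solution $\Psi=(\Psi_1,\Psi_2)^T\in H^1(\mathbb{R};\mathbb{C}^2)$ with $$|k-1|+|v|+\|\Psi-\mathbf{\Psi}_1\|_{L^\infty}\le C\,\|Q-Q_1\|_{L^2}.$$ 2. If moreover $Q\in H^3(\mathbb{R})$, then for every nonzero solution $\Psi=(\Psi_1,\Psi_2)^T\in H^1(\mathbb{R};\mathbb{C}^2)$ of $(\ast)$ (with this $\eta$), $|\Psi_1|^2+|\Psi_2|^2\neq 0$ almost everywhere, and the function $$q:=-Q-\frac{2k\,\Psi_1\overline{\Psi_2}}{|\Psi_1|^2+|\Psi_2|^2}$$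 belongs to $H^3(\mathbb{R})$ and satisfies $\|q\|_{L^2}\le C\,\|Q-Q_1\|_{L^2}$. Here derivatives are understood in the weak sense. -/

import Mathlib

open MeasureTheory
open scoped NNReal ENNReal ComplexConjugate ContDiff Matrix

noncomputable section

/-- `g` is the weak derivative of `f` on the real line: both are locally integrable and
`∫ φ' f = - ∫ φ g` for all test functions `φ ∈ C_c^∞(ℝ)`. -/
structure HasWeakDeriv {E : Type*} [NormedAddCommGroup E] [NormedSpace ℝ E]
    (f g : ℝ → E) : Prop where
  locallyIntegrable : LocallyIntegrable f
  locallyIntegrable_deriv : LocallyIntegrable g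
  integral_eq : ∀ φ : ℝ → ℝ, ContDiff ℝ ∞ φ → HasCompactSupport φ →
    ∫ x, deriv φ x • f x = - ∫ x, φ x • g x

/-- `f` belongs to the Sobolev space `H^n(ℝ; E)`: `f` and its weak derivatives up to order `n`
are square integrable. -/
def MemH {E : Type*} [NormedAddCommGroup E] [NormedSpace ℝ E] : ℕ → (ℝ → E) → Prop
  | 0, f => MemLp f 2
  | n + 1, f => MemLp f 2 ∧ ∃ g : ℝ → E, HasWeakDeriv f g ∧ MemH n g

/-- The soliton profile `sech x`, as a complex-valued function. -/
def solitonProfile (x : ℝ) : ℂ := ((Real.cosh x)⁻¹ : ℝ)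

/-- The explicit eigenvector `sech x · (-e^{-x/2}, e^{x/2})` for the potential `sech` and the
eigenvalue `1/2`. -/
def solitonEigenvector (x : ℝ) : Fin 2 → ℂ :=
  solitonProfile x • ![((-Real.exp (-x / 2) : ℝ) : ℂ), ((Real.exp (x / 2) : ℝ) : ℂ)]

/-- The matrix `[[η, Q], [-Q̄, -η]]`. -/
def laxMatrix (η Q : ℂ) : Matrix (Fin 2) (Fin 2) ℂ :=
  !![η, Q; -conj Q, -η]

/-- `Ψ` is an `H¹(ℝ; ℂ²)` eigenvector, i.e. a solution in `H¹` which is not (a.e.) zero, of the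
spectral problem `∂ₓ Ψ = [[η, Q], [-Q̄, -η]] Ψ`. -/
structure IsLaxEigenvector (η : ℂ) (Q : ℝ → ℂ) (Ψ : ℝ → Fin 2 → ℂ) : Prop where
  memH : MemH 1 Ψ
  ne_zero : ¬ Ψ =ᵐ[volume] 0
  eqn : HasWeakDeriv Ψ (fun x => laxMatrix η (Q x) *ᵥ Ψ x)

/-- The Bäcklund transform `q = -Q - 2k Ψ₁ Ψ̄₂ / (|Ψ₁|² + |Ψ₂|²)`. -/
def backlundTransform (k : ℝ) (Q : ℝ → ℂ) (Ψ : ℝ → Fin 2 → ℂ) (x : ℝ) : ℂ :=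
  -Q x - 2 * (k : ℂ) * Ψ x 0 * conj (Ψ x 1) / ((‖Ψ x 0‖ ^ 2 + ‖Ψ x 1‖ ^ 2 : ℝ) : ℂ)

end

/-! The soliton eigenvector is `√2 cosh^{-1/2}` times the unit vector `(-c, s)`, with `c = frameCos`
and `s = frameSin`. For `Q = sech + p` and `η = 1/2 + μ`, look for an eigenvector `a ((-c, s) + t
(s, c))` in this orthonormal frame. The spectral problem becomes a Riccati equation `t' = tanh · t -
μ sech + N(p, t, μ)` and a linear equation for `a`.

Since `cosh` solves the homogeneous linear part, a bounded `t` exists only if the forcing is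
orthogonal to `sech`. This condition determines `μ`, hence `k` and `v`. `exists_riccati_solution`
solves for `(t, μ)` by contraction in bounded continuous functions times `ℂ`, with both of size
`O(δ)`, `δ = ‖p‖₂`. An energy identity for `tanh |t|²` (`riccati_sq_integrable`) then gives `‖t‖₂ =
O(δ)`. Hence `a` equals the soliton amplitude times the exponential of a small correction, which
proves the first claim.

For the second claim, every `H¹` eigenvector is a constant multiple of the constructed one: the
Wronskian is constant and integrable, so it vanishes (`IsLaxSolution.wronskian_eq_zero`,
`IsLaxSolution.exists_eq_mul`). The Bäcklund transform does not see the constant. With `P = Ψ₁ Ψ̄₂ /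
|Ψ|²`, the sum `P + sech / 2` is controlled by `t` in `L²`, so `q = -p + (k - 1) sech - 2k (P + sech
/ 2)` is `O(δ)` in `L²`. Smoothness comes from a closed differential system for `P` and `D = (|Ψ₁|²
- |Ψ₂|²) / |Ψ|²`, by which `P` gains one derivative over `Q` (`IsLaxSolution.memH_crossRatio`). -/

open Set Filter Topology

/-! ### Calculus of locally absolutely continuous functions. -/

section AbsolutelyContinuous

/-- The comparison function `g` may take values in another space. This one principle handles linear
images, primitives, exponentials and inverses. -/
theorem AbsolutelyContinuousOnInterval.of_dist_le {X Y : Type*} [PseudoMetricSpace X]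
    [PseudoMetricSpace Y] {f : ℝ → X} {g : ℝ → Y} {a b K : ℝ}
    (hg : AbsolutelyContinuousOnInterval g a b)
    (h : ∀ x ∈ uIcc a b, ∀ y ∈ uIcc a b, dist (f x) (f y) ≤ K * dist (g x) (g y)) :
    AbsolutelyContinuousOnInterval f a b := by
  rw [absolutelyContinuousOnInterval_iff] at hg ⊢
  intro ε hε
  obtain ⟨δ, hδ, hE⟩ := hg (ε / (|K| + 1)) (by positivity)
  refine ⟨δ, hδ, fun E hEd hEl => ?_⟩
  have h1 := hE E hEd hEl
  calc ∑ i ∈ Finset.range E.1, dist (f (E.2 i).1) (f (E.2 i).2)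
      ≤ ∑ i ∈ Finset.range E.1, (|K| + 1) * dist (g (E.2 i).1) (g (E.2 i).2) := by
        refine Finset.sum_le_sum fun i hi => (h _ (hEd.1 i hi).1 _ (hEd.1 i hi).2).trans ?_
        gcongr
        linarith [le_abs_self K]
    _ = (|K| + 1) * ∑ i ∈ Finset.range E.1, dist (g (E.2 i).1) (g (E.2 i).2) := by
        rw [Finset.mul_sum]
    _ < (|K| + 1) * (ε / (|K| + 1)) := by gcongr
    _ = ε := by field_simp

theorem MeasureTheory.LocallyIntegrable.intervalIntegrable_real {E : Type*} [NormedAddCommGroup E]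
    {f : ℝ → E} (hf : LocallyIntegrable f) (a b : ℝ) : IntervalIntegrable f volume a b :=
  (hf.integrableOn_isCompact isCompact_uIcc).intervalIntegrable

theorem MeasureTheory.LocallyIntegrable.norm_real {E : Type*} [NormedAddCommGroup E]
    {f : ℝ → E} (hf : LocallyIntegrable f) : LocallyIntegrable fun x => ‖f x‖ := fun x => by
  obtain ⟨s, hs, hi⟩ := hf x
  exact ⟨s, hs, hi.norm⟩

/-- `f` is locally absolutely continuous with almost everywhere derivative `g`. -/
structure HasACDeriv {E : Type*} [NormedAddCommGroup E] [NormedSpace ℝ E]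
    (f g : ℝ → E) : Prop where
  ac : ∀ a b, AbsolutelyContinuousOnInterval f a b
  locallyIntegrable : LocallyIntegrable g
  hasDerivAt : ∀ᵐ x, HasDerivAt f (g x) x

namespace HasACDeriv

variable {E : Type*} [NormedAddCommGroup E] [NormedSpace ℝ E] {f g h k : ℝ → E}

theorem continuous (hf : HasACDeriv f g) : Continuous f := by
  refine continuous_iff_continuousAt.2 fun x => ?_
  refine (hf.ac (x - 1) (x + 1)).continuousOn.continuousAt ?_
  rw [uIcc_of_le (by linarith)]
  exact Icc_mem_nhds (by linarith) (by linarith)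

theorem intervalIntegrable (hf : HasACDeriv f g) (a b : ℝ) : IntervalIntegrable g volume a b :=
  hf.locallyIntegrable.intervalIntegrable_real a b

theorem congr_deriv (hf : HasACDeriv f g) (hgh : g =ᵐ[volume] h) : HasACDeriv f h where
  ac := hf.ac
  locallyIntegrable := hf.locallyIntegrable.congr hgh
  hasDerivAt := by
    filter_upwards [hf.hasDerivAt, hgh] with x h1 h2
    rwa [← h2]

theorem of_eq_deriv (hf : HasACDeriv f g) (hgh : ∀ x, g x = h x) : HasACDeriv f h :=
  hf.congr_deriv (Eventually.of_forall hgh)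

theorem of_hasDerivAt (hf : ∀ x, HasDerivAt f (g x) x) (hg : Continuous g) : HasACDeriv f g where
  ac a b := by
    refine ContDiffOn.absolutelyContinuousOnInterval (ContDiff.contDiffOn ?_)
    refine contDiff_one_iff_deriv.2 ⟨fun x => (hf x).differentiableAt, ?_⟩
    rwa [funext fun x => (hf x).deriv]
  locallyIntegrable := hg.locallyIntegrable
  hasDerivAt := Eventually.of_forall hf

theorem const (c : E) : HasACDeriv (fun _ => c) (fun _ => 0) :=
  of_hasDerivAt (fun x => hasDerivAt_const x c) continuous_const

theorem add (hf : HasACDeriv f g) (hh : HasACDeriv h k) :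
    HasACDeriv (fun x => f x + h x) (fun x => g x + k x) where
  ac a b := (hf.ac a b).add (hh.ac a b)
  locallyIntegrable := hf.locallyIntegrable.add hh.locallyIntegrable
  hasDerivAt := by
    filter_upwards [hf.hasDerivAt, hh.hasDerivAt] with x h1 h2 using h1.add h2

theorem neg (hf : HasACDeriv f g) : HasACDeriv (fun x => -f x) (fun x => -g x) where
  ac a b := (hf.ac a b).neg
  locallyIntegrable := hf.locallyIntegrable.neg
  hasDerivAt := by filter_upwards [hf.hasDerivAt] with x h1 using h1.neg

theorem sub (hf : HasACDeriv f g) (hh : HasACDeriv h k) :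
    HasACDeriv (fun x => f x - h x) (fun x => g x - k x) := by
  simpa only [sub_eq_add_neg] using hf.add hh.neg

theorem clm {F : Type*} [NormedAddCommGroup F] [NormedSpace ℝ F] (L : E →L[ℝ] F)
    (hf : HasACDeriv f g) : HasACDeriv (fun x => L (f x)) (fun x => L (g x)) where
  ac a b := (hf.ac a b).of_dist_le (K := ‖L‖) fun x _ y _ => by
    rw [dist_eq_norm, dist_eq_norm, ← map_sub]
    exact L.le_opNorm _
  locallyIntegrable x := by
    obtain ⟨s, hs, hi⟩ := hf.locallyIntegrable x
    exact ⟨s, hs, L.integrable_comp hi⟩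
  hasDerivAt := by
    filter_upwards [hf.hasDerivAt] with x h1 using L.hasFDerivAt.comp_hasDerivAt x h1

theorem smul {𝕜 : Type*} [NormedField 𝕜] [NormedAlgebra ℝ 𝕜] [NormedSpace 𝕜 E]
    [IsScalarTower ℝ 𝕜 E] {u v : ℝ → 𝕜} (hu : HasACDeriv u v)
    (hf : HasACDeriv f g) :
    HasACDeriv (fun x => u x • f x) (fun x => u x • g x + v x • f x) where
  ac a b := (hu.ac a b).smul (hf.ac a b)
  locallyIntegrable := by
    rw [← locallyIntegrableOn_univ]
    refine LocallyIntegrableOn.add ?_ ?_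
    · exact (locallyIntegrableOn_univ.2 hf.locallyIntegrable).continuousOn_smul
        isOpen_univ.isLocallyClosed hu.continuous.continuousOn
    · exact (locallyIntegrableOn_univ.2 hu.locallyIntegrable).smul_continuousOn
        isOpen_univ.isLocallyClosed hf.continuous.continuousOn
  hasDerivAt := by
    filter_upwards [hu.hasDerivAt, hf.hasDerivAt] with x h1 h2 using h1.smul h2

theorem integral_of_locallyIntegrable [CompleteSpace E] (hg : LocallyIntegrable g) (a : ℝ) :
    HasACDeriv (fun x => ∫ y in a..x, g y) g where
  ac b c := by
    -- Increments of the vector-valued primitive are dominated by those of the real primitive of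
    -- `‖g‖`.
    have hn : LocallyIntegrable (fun x => ‖g x‖) := hg.norm_real
    have h1 : AbsolutelyContinuousOnInterval (fun x => ∫ y in b..x, ‖g y‖) b c :=
      (hn.intervalIntegrable_real b c).absolutelyContinuousOnInterval_intervalIntegral left_mem_uIcc
    refine h1.of_dist_le (K := 1) fun x _ y _ => ?_
    rw [one_mul, dist_eq_norm, dist_eq_norm,
      intervalIntegral.integral_interval_sub_left (hg.intervalIntegrable_real _ _)
        (hg.intervalIntegrable_real _ _),
      intervalIntegral.integral_interval_sub_left (hn.intervalIntegrable_real _ _)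
        (hn.intervalIntegrable_real _ _)]
    exact intervalIntegral.norm_integral_le_abs_integral_norm
  locallyIntegrable := hg
  hasDerivAt := by
    filter_upwards [LocallyIntegrable.ae_hasDerivAt_integral hg] with x hx using hx a

/-- Subtracting the primitive of `g` leaves an absolutely continuous function with derivative zero
almost everywhere, which is constant. -/
theorem integral_eq_sub [CompleteSpace E] (hf : HasACDeriv f g) (a b : ℝ) :
    ∫ x in a..b, g x = f b - f a := by
  have h1 := hf.sub (integral_of_locallyIntegrable hf.locallyIntegrable a)
  obtain ⟨C, hC⟩ := (h1.ac a b).const_of_ae_hasDerivAt_zero (by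
    filter_upwards [h1.hasDerivAt] with x hx _
    simpa using hx)
  have ha := hC a left_mem_uIcc
  have hb := hC b right_mem_uIcc
  simp only [intervalIntegral.integral_same, sub_zero] at ha
  rw [← ha] at hb
  rw [← hb]; abel

theorem eq_const [CompleteSpace E] (hf : HasACDeriv f (fun _ => 0)) (a b : ℝ) : f a = f b := by
  have := hf.integral_eq_sub a b
  simp only [intervalIntegral.integral_zero] at this
  exact (sub_eq_zero.1 this.symm).symm

theorem mul {u v p q : ℝ → ℂ} (hu : HasACDeriv u v) (hp : HasACDeriv p q) :
    HasACDeriv (fun x => u x * p x) (fun x => v x * p x + u x * q x) :=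
  (hu.smul hp).of_eq_deriv fun x => by simp only [smul_eq_mul]; ring

theorem const_mul {u v : ℝ → ℂ} (c : ℂ) (hu : HasACDeriv u v) :
    HasACDeriv (fun x => c * u x) (fun x => c * v x) :=
  ((const c).mul hu).of_eq_deriv fun x => by ring

theorem star {u v : ℝ → ℂ} (hu : HasACDeriv u v) :
    HasACDeriv (fun x => conj (u x)) (fun x => conj (v x)) :=
  hu.clm Complex.conjCLE.toContinuousLinearMap

theorem ofReal {u v : ℝ → ℝ} (hu : HasACDeriv u v) :
    HasACDeriv (fun x => (u x : ℂ)) (fun x => (v x : ℂ)) :=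
  hu.clm Complex.ofRealCLM

theorem comp_of_hasDerivAt {u v : ℝ → ℂ} {φ φ' : ℂ → ℂ} (hu : HasACDeriv u v)
    (hφ : ∀ x, HasDerivAt φ (φ' (u x)) (u x))
    (hφ' : Continuous fun x => φ' (u x))
    (hlip : ∀ a b, ∃ K, ∀ x ∈ uIcc a b, ∀ y ∈ uIcc a b,
      dist (φ (u x)) (φ (u y)) ≤ K * dist (u x) (u y)) :
    HasACDeriv (fun x => φ (u x)) (fun x => φ' (u x) * v x) where
  ac a b := by
    obtain ⟨K, hK⟩ := hlip a b
    exact (hu.ac a b).of_dist_le hK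
  locallyIntegrable := by
    rw [← locallyIntegrableOn_univ]
    exact (locallyIntegrableOn_univ.2 hu.locallyIntegrable).continuousOn_smul
        isOpen_univ.isLocallyClosed hφ'.continuousOn
  hasDerivAt := by
    filter_upwards [hu.hasDerivAt] with x h1 using (hφ x).comp x h1

theorem cexp {u v : ℝ → ℂ} (hu : HasACDeriv u v) :
    HasACDeriv (fun x => Complex.exp (u x)) (fun x => Complex.exp (u x) * v x) := by
  refine hu.comp_of_hasDerivAt (fun x => Complex.hasDerivAt_exp _)
    (Complex.continuous_exp.comp hu.continuous) fun a b => ?_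
  obtain ⟨C, hC⟩ := (isCompact_uIcc (a := a) (b := b)).exists_bound_of_continuousOn
    hu.continuous.continuousOn
  refine ⟨Real.exp C, fun x hx y hy => ?_⟩
  have h := (convex_closedBall (0 : ℂ) C).norm_image_sub_le_of_norm_deriv_le (𝕜 := ℂ)
    (f := Complex.exp) (C := Real.exp C) (x := u y) (y := u x)
    (fun z _ => Complex.differentiableAt_exp) (fun z hz => ?_)
    (mem_closedBall_zero_iff.2 (hC y hy)) (mem_closedBall_zero_iff.2 (hC x hx))
  · rwa [dist_eq_norm, dist_eq_norm]
  · rw [Complex.deriv_exp, Complex.norm_exp]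
    exact Real.exp_le_exp.2 ((Complex.re_le_norm z).trans (mem_closedBall_zero_iff.1 hz))

theorem inv {u v : ℝ → ℂ} (hu : HasACDeriv u v) (h0 : ∀ x, u x ≠ 0) :
    HasACDeriv (fun x => (u x)⁻¹) (fun x => -((u x) ^ 2)⁻¹ * v x) := by
  have hc := hu.continuous
  refine hu.comp_of_hasDerivAt (φ := fun z => z⁻¹) (φ' := fun z => -(z ^ 2)⁻¹)
    (fun x => hasDerivAt_inv (h0 x))
    ((hc.pow 2).inv₀ fun x => pow_ne_zero _ (h0 x)).neg fun a b => ?_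
  obtain ⟨C, hC⟩ := (isCompact_uIcc (a := a) (b := b)).exists_bound_of_continuousOn
    (hc.inv₀ h0).continuousOn
  refine ⟨C * C, fun x hx y hy => ?_⟩
  rw [dist_inv_inv₀ (h0 x) (h0 y), div_eq_mul_inv, mul_inv, ← norm_inv, ← norm_inv, mul_comm]
  have h1 : ‖(u x)⁻¹‖ ≤ C := hC x hx
  have h2 : ‖(u y)⁻¹‖ ≤ C := hC y hy
  gcongr
  exact (norm_nonneg _).trans h1

end HasACDeriv

end AbsolutelyContinuous

/-! ### Weak derivatives correspond to absolutely continuous representatives. -/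

section WeakDerivative

variable {E : Type*} [NormedAddCommGroup E] [NormedSpace ℝ E]

/-- Integrate `(φ f)'` over `[-x, x]`: the result is zero once the interval contains the support of
`φ`. -/
theorem HasACDeriv.hasWeakDeriv [CompleteSpace E] {f g : ℝ → E} (hf : HasACDeriv f g) :
    HasWeakDeriv f g where
  locallyIntegrable := hf.continuous.locallyIntegrable
  locallyIntegrable_deriv := hf.locallyIntegrable
  integral_eq φ hφ hs := by
    have hφ1 : ContDiff ℝ 1 φ := hφ.of_le (by exact_mod_cast le_top)
    have hd : HasACDeriv φ (deriv φ) := HasACDeriv.of_hasDerivAt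
      (fun x => (hφ1.differentiable one_ne_zero x).hasDerivAt) (hφ1.continuous_deriv le_rfl)
    have hp := hd.smul hf
    have hi1 : Integrable (fun x => φ x • g x) :=
      hf.locallyIntegrable.integrable_smul_left_of_hasCompactSupport hφ.continuous hs
    have hi2 : Integrable (fun x => deriv φ x • f x) :=
      hf.continuous.locallyIntegrable.integrable_smul_left_of_hasCompactSupport
        (hφ1.continuous_deriv le_rfl) hs.deriv
    have hlim := intervalIntegral_tendsto_integral (hi1.add hi2) tendsto_neg_atTop_atBot tendsto_id
    obtain ⟨R, hR⟩ := hs.isCompact.isBounded.subset_closedBall 0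
    have hφ0 : ∀ x, R < |x| → φ x = 0 := fun x hx => by
      by_contra h
      have := hR (subset_tsupport _ h)
      rw [mem_closedBall_zero_iff, Real.norm_eq_abs] at this
      linarith
    have hev : (fun x : ℝ => ∫ y in -x..id x, (φ y • g y + deriv φ y • f y))
        =ᶠ[atTop] fun _ => 0 := by
      filter_upwards [eventually_gt_atTop |R|] with x hx
      have hx' : R < |x| := (le_abs_self R).trans_lt (hx.trans_le (le_abs_self x))
      rw [hp.integral_eq_sub, id, hφ0 x hx', hφ0 (-x) (by rwa [abs_neg]), zero_smul, zero_smul,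
        sub_zero]
    have h0 := tendsto_nhds_unique (hlim.congr' hev) tendsto_const_nhds
    have h1 : ∫ x, (φ x • g x + deriv φ x • f x) = 0 := h0
    rw [integral_add hi1 hi2] at h1
    exact eq_neg_of_add_eq_zero_right h1

theorem HasWeakDeriv.congr {f g f' g' : ℝ → E} (h : HasWeakDeriv f g)
    (hf : f =ᵐ[volume] f') (hg : g =ᵐ[volume] g') : HasWeakDeriv f' g' where
  locallyIntegrable := h.locallyIntegrable.congr hf
  locallyIntegrable_deriv := h.locallyIntegrable_deriv.congr hg
  integral_eq φ hφ hs := by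
    rw [integral_congr_ae (g := fun x => deriv φ x • f x), h.integral_eq φ hφ hs,
      integral_congr_ae]
    · filter_upwards [hg] with x hx
      rw [hx]
    · filter_upwards [hf] with x hx
      rw [hx]

/-- A test function with vanishing integral is the derivative of a test function. -/
theorem exists_test_primitive {θ : ℝ → ℝ} (hθ : ContDiff ℝ ∞ θ) (hs : HasCompactSupport θ)
    (h0 : ∫ x, θ x = 0) :
    ∃ ψ : ℝ → ℝ, ContDiff ℝ ∞ ψ ∧ HasCompactSupport ψ ∧ deriv ψ = θ := by
  obtain ⟨R, hR⟩ := hs.isCompact.isBounded.subset_closedBall 0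
  have hθ0 : ∀ x, R < |x| → θ x = 0 := fun x hx => by
    by_contra h
    have := hR (subset_tsupport _ h)
    rw [mem_closedBall_zero_iff, Real.norm_eq_abs] at this
    linarith
  have hd : ∀ x, HasDerivAt (fun x => ∫ y in Iic x, θ y) (θ x) x := fun x => by
    have hi : Integrable θ := hθ.continuous.integrable_of_hasCompactSupport hs
    have h1 : HasDerivAt (fun x => (∫ y in Iic (0 : ℝ), θ y) + ∫ y in (0 : ℝ)..x, θ y) (θ x) x :=
      (hθ.continuous.integral_hasStrictDerivAt 0 x).hasDerivAt.const_add _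
    refine h1.congr_of_eventuallyEq (Eventually.of_forall fun z => ?_)
    have := intervalIntegral.integral_Iic_sub_Iic (a := 0) (b := z) (f := θ) (μ := volume)
      hi.integrableOn hi.integrableOn
    simp only
    rw [← this]; ring
  have hderiv : deriv (fun x => ∫ y in Iic x, θ y) = θ := funext fun x => (hd x).deriv
  refine ⟨fun x => ∫ y in Iic x, θ y, ?_, ?_, hderiv⟩
  · refine contDiff_infty_iff_deriv.2 ⟨fun x => (hd x).differentiableAt, ?_⟩
    rwa [hderiv]
  · refine HasCompactSupport.of_support_subset_isCompact (K := Icc (-|R|) |R|) isCompact_Icc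
      fun x hx => ?_
    by_contra hxR
    refine hx ?_
    simp only [mem_Icc, not_and_or, not_le] at hxR
    rcases hxR with h | h
    · refine setIntegral_eq_zero_of_forall_eq_zero fun y hy => hθ0 y ?_
      have : y ≤ x := hy
      rw [abs_of_neg (by linarith [abs_nonneg R])]
      linarith [le_abs_self R]
    · have hi : Integrable θ := hθ.continuous.integrable_of_hasCompactSupport hs
      have h2 := intervalIntegral.integral_Iic_add_Ioi (b := x) (f := θ) (μ := volume)
        hi.integrableOn hi.integrableOn
      have h3 : ∫ y in Ioi x, θ y = 0 :=
        setIntegral_eq_zero_of_forall_eq_zero fun y hy => hθ0 y (by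
          have : x < y := hy
          rw [abs_of_pos (by linarith [abs_nonneg R])]
          linarith [le_abs_self R])
      simp only
      rw [h3, add_zero, h0] at h2
      exact h2

/-- The du Bois-Reymond lemma. -/
theorem ae_eq_const_of_integral_deriv_smul_eq_zero [CompleteSpace E] {h : ℝ → E}
    (hh : LocallyIntegrable h)
    (h0 : ∀ φ : ℝ → ℝ, ContDiff ℝ ∞ φ → HasCompactSupport φ → ∫ x, deriv φ x • h x = 0) :
    ∃ c, ∀ᵐ x, h x = c := by
  let b : ContDiffBump (0 : ℝ) := default
  let χ : ℝ → ℝ := b.normed volume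
  have hχ : ContDiff ℝ ∞ χ := b.contDiff_normed
  have hχs : HasCompactSupport χ := b.hasCompactSupport_normed
  have hχ1 : ∫ x, χ x = 1 := b.integral_normed
  refine ⟨∫ x, χ x • h x, ?_⟩
  have hc : LocallyIntegrable (fun _ : ℝ => ∫ x, χ x • h x) :=
    continuous_const.locallyIntegrable
  refine ae_eq_of_integral_contDiff_smul_eq hh hc fun φ hφ hφs => ?_
  have hi : Integrable φ := hφ.continuous.integrable_of_hasCompactSupport hφs
  have hiχ : Integrable χ := hχ.continuous.integrable_of_hasCompactSupport hχs
  set m := ∫ x, φ x with hm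
  -- Removing the mean of `φ` with the unit-mass bump `χ` makes it the derivative of a test
  -- function.
  obtain ⟨ψ, hψ, hψs, hψd⟩ := exists_test_primitive (θ := fun x => φ x - m * χ x)
    (hφ.sub (contDiff_const.mul hχ)) (hφs.sub hχs.mul_left) (by
      rw [integral_sub hi (hiχ.const_mul _), integral_const_mul, hχ1, mul_one, sub_self])
  have h1 := h0 ψ hψ hψs
  rw [hψd] at h1
  have hi1 : Integrable fun x => φ x • h x :=
    hh.integrable_smul_left_of_hasCompactSupport hφ.continuous hφs
  have hi2 : Integrable fun x => χ x • h x :=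
    hh.integrable_smul_left_of_hasCompactSupport hχ.continuous hχs
  have h2 : ∫ x, (φ x - m * χ x) • h x = ∫ x, (φ x • h x - m • χ x • h x) := by
    congr 1; ext x; rw [sub_smul, mul_smul]
  have hi3 : Integrable fun x => m • χ x • h x := hi2.smul m
  rw [h2, integral_sub hi1 hi3, integral_smul, sub_eq_zero] at h1
  rw [h1, integral_smul_const]

/-- The difference between `f` and a primitive of `g` has weak derivative zero, so du Bois-Reymond
applies. Pointwise calculus then becomes available for weak solutions. -/
theorem HasWeakDeriv.exists_hasACDeriv [CompleteSpace E] {f g : ℝ → E} (h : HasWeakDeriv f g) :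
    ∃ F, f =ᵐ[volume] F ∧ HasACDeriv F g := by
  have hF := HasACDeriv.integral_of_locallyIntegrable h.locallyIntegrable_deriv 0
  have hFw := hF.hasWeakDeriv
  obtain ⟨c, hc⟩ := ae_eq_const_of_integral_deriv_smul_eq_zero
    (h.locallyIntegrable.sub hFw.locallyIntegrable) fun φ hφ hs => by
      have hφ1 : ContDiff ℝ 1 φ := hφ.of_le (by exact_mod_cast le_top)
      simp only [Pi.sub_apply, smul_sub]
      rw [integral_sub, h.integral_eq φ hφ hs, hFw.integral_eq φ hφ hs, sub_self]
      · exact h.locallyIntegrable.integrable_smul_left_of_hasCompactSupport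
          (hφ1.continuous_deriv le_rfl) hs.deriv
      · exact hFw.locallyIntegrable.integrable_smul_left_of_hasCompactSupport
          (hφ1.continuous_deriv le_rfl) hs.deriv
  refine ⟨fun x => (∫ y in (0 : ℝ)..x, g y) + c, ?_, ?_⟩
  · filter_upwards [hc] with x hx
    rw [← hx, Pi.sub_apply]; abel
  · exact (hF.add (HasACDeriv.const c)).of_eq_deriv fun x => by simp

end WeakDerivative

/-! ### Products in Sobolev spaces on the line. -/

section Sobolev

theorem HasWeakDeriv.add {f g f' g' : ℝ → ℂ} (h : HasWeakDeriv f g) (h' : HasWeakDeriv f' g') :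
    HasWeakDeriv (fun x => f x + f' x) (fun x => g x + g' x) := by
  obtain ⟨F, hF, hFd⟩ := h.exists_hasACDeriv
  obtain ⟨F', hF', hFd'⟩ := h'.exists_hasACDeriv
  refine (hFd.add hFd').hasWeakDeriv.congr ?_ (ae_eq_refl _)
  filter_upwards [hF, hF'] with x h1 h2
  rw [h1, h2]

theorem HasWeakDeriv.mul {f g f' g' : ℝ → ℂ} (h : HasWeakDeriv f g) (h' : HasWeakDeriv f' g') :
    HasWeakDeriv (fun x => f x * f' x) (fun x => g x * f' x + f x * g' x) := by
  obtain ⟨F, hF, hFd⟩ := h.exists_hasACDeriv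
  obtain ⟨F', hF', hFd'⟩ := h'.exists_hasACDeriv
  refine (hFd.mul hFd').hasWeakDeriv.congr ?_ ?_
  all_goals
    filter_upwards [hF, hF'] with x h1 h2
    rw [h1, h2]

theorem HasWeakDeriv.const_mul {f g : ℝ → ℂ} (c : ℂ) (h : HasWeakDeriv f g) :
    HasWeakDeriv (fun x => c * f x) (fun x => c * g x) := by
  obtain ⟨F, hF, hFd⟩ := h.exists_hasACDeriv
  refine (hFd.const_mul c).hasWeakDeriv.congr ?_ (ae_eq_refl _)
  filter_upwards [hF] with x h1
  rw [h1]

theorem HasWeakDeriv.star {f g : ℝ → ℂ} (h : HasWeakDeriv f g) :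
    HasWeakDeriv (fun x => conj (f x)) (fun x => conj (g x)) := by
  obtain ⟨F, hF, hFd⟩ := h.exists_hasACDeriv
  refine hFd.star.hasWeakDeriv.congr ?_ (ae_eq_refl _)
  filter_upwards [hF] with x h1
  rw [h1]

theorem MeasureTheory.MemLp.star_complex {f : ℝ → ℂ} {p : ℝ≥0∞} (hf : MemLp f p) :
    MemLp (fun x => conj (f x)) p :=
  hf.of_le (Complex.continuous_conj.comp_aestronglyMeasurable hf.1)
    (Eventually.of_forall fun x => by rw [RCLike.norm_conj])

theorem MeasureTheory.MemLp.bounded_mul {f g : ℝ → ℂ} {p : ℝ≥0∞} {C : ℝ}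
    (hg : AEStronglyMeasurable g) (hC : ∀ᵐ x, ‖g x‖ ≤ C) (hf : MemLp f p) :
    MemLp (fun x => g x * f x) p :=
  hf.of_le_mul (c := C) (hg.mul hf.1) (by
    filter_upwards [hC] with x hx
    rw [norm_mul]
    gcongr)

namespace MemH

variable {f g : ℝ → ℂ} {n : ℕ}

theorem memLp (hf : MemH n f) : MemLp f 2 := by
  cases n with
  | zero => exact hf
  | succ n => exact hf.1

theorem of_succ (hf : MemH (n + 1) f) : MemH n f := by
  induction n generalizing f with
  | zero => exact hf.1
  | succ n ih =>
    obtain ⟨h, g, hg, hgn⟩ := hf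
    exact ⟨h, g, hg, ih hgn⟩

theorem congr (hf : MemH n f) (hfg : f =ᵐ[volume] g) : MemH n g := by
  cases n with
  | zero => exact MemLp.ae_eq hfg hf
  | succ n =>
    obtain ⟨h, u, hu, hun⟩ := hf
    exact ⟨h.ae_eq hfg, u, hu.congr hfg (ae_eq_refl _), hun⟩

theorem add (hf : MemH n f) (hg : MemH n g) : MemH n fun x => f x + g x := by
  induction n generalizing f g with
  | zero => exact MemLp.add hf hg
  | succ n ih =>
    obtain ⟨h, u, hu, hun⟩ := hf
    obtain ⟨h', u', hu', hun'⟩ := hg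
    exact ⟨h.add h', _, hu.add hu', ih hun hun'⟩

theorem const_mul (c : ℂ) (hf : MemH n f) : MemH n fun x => c * f x := by
  induction n generalizing f with
  | zero => exact MemLp.const_mul hf c
  | succ n ih =>
    obtain ⟨h, u, hu, hun⟩ := hf
    exact ⟨h.const_mul c, _, hu.const_mul c, ih hun⟩

theorem star (hf : MemH n f) : MemH n fun x => conj (f x) := by
  induction n generalizing f with
  | zero => exact MemLp.star_complex hf
  | succ n ih =>
    obtain ⟨h, u, hu, hun⟩ := hf
    exact ⟨h.star_complex, _, hu.star, ih hun⟩

/-- The square of the continuous representative has the integrable derivative `2 f f'`, so it stays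
within a finite distance of its value at `0`. -/
theorem exists_bound (hf : MemH (n + 1) f) : ∃ C, ∀ᵐ x, ‖f x‖ ≤ C := by
  obtain ⟨h, u, hu, hun⟩ := hf
  obtain ⟨F, hF, hFd⟩ := hu.exists_hasACDeriv
  have hF2 : MemLp F 2 := h.ae_eq hF
  have hi : Integrable fun x => u x * F x + F x * u x :=
    (hun.memLp.integrable_mul hF2).add (hF2.integrable_mul hun.memLp)
  refine ⟨√(‖F 0 * F 0‖ + ∫ x, ‖u x * F x + F x * u x‖), ?_⟩
  filter_upwards [hF] with x hx
  rw [hx]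
  refine Real.le_sqrt_of_sq_le ?_
  have h1 := (hFd.mul hFd).integral_eq_sub 0 x
  have h2 : F x * F x = F 0 * F 0 + ∫ y in (0 : ℝ)..x, (u y * F y + F y * u y) := by
    rw [h1]; ring
  rw [sq, ← norm_mul, h2]
  refine (norm_add_le _ _).trans ?_
  gcongr
  refine intervalIntegral.norm_integral_le_integral_norm_uIoc.trans ?_
  exact setIntegral_le_integral hi.norm (Eventually.of_forall fun x => norm_nonneg _)

/-- The two claims are proved together because they feed each other: the first at level `n` bounds
both Leibniz terms in the second, and the second gives the first at level `n + 1`. -/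
theorem mul_mem_and_mul_mem_succ : (∀ f g : ℝ → ℂ, MemH n f → MemH (n + 1) g → MemH n fun x => f x * g x) ∧
    ∀ f g : ℝ → ℂ, MemH (n + 1) f → MemH (n + 1) g → MemH (n + 1) fun x => f x * g x := by
  have key : ∀ n : ℕ, (∀ f g : ℝ → ℂ, MemH n f → MemH (n + 1) g → MemH n fun x => f x * g x) →
      ∀ f g : ℝ → ℂ, MemH (n + 1) f → MemH (n + 1) g → MemH (n + 1) fun x => f x * g x := by
    intro n ih f g hf hg
    obtain ⟨C, hC⟩ := hf.exists_bound
    obtain ⟨h, u, hu, hun⟩ := hf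
    obtain ⟨h', u', hu', hun'⟩ := hg
    refine ⟨h'.bounded_mul h.1 hC, _, hu.mul hu', (ih _ _ hun ⟨h', u', hu', hun'⟩).add ?_⟩
    simpa only [mul_comm] using ih _ _ hun' ⟨h, u, hu, hun⟩
  have key0 : ∀ n : ℕ, ∀ f g : ℝ → ℂ, MemH n f → MemH (n + 1) g → MemH n fun x => f x * g x := by
    intro n
    induction n with
    | zero =>
      intro f g hf hg
      obtain ⟨C, hC⟩ := hg.exists_bound
      have := MemLp.bounded_mul hg.memLp.1 hC hf.memLp
      simp only [mul_comm (f _)]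
      exact this
    | succ n ih => exact fun f g hf hg => key n ih f g hf hg.of_succ
  exact ⟨key0 n, key n (key0 n)⟩

theorem mul (hf : MemH (n + 1) f) (hg : MemH (n + 1) g) : MemH (n + 1) fun x => f x * g x :=
  mul_mem_and_mul_mem_succ.2 f g hf hg

/-- Meant for a factor such as `diffRatio`, which need not be square integrable (it is `-tanh` for
the soliton) although its derivative is in a Sobolev space. -/
theorem mul_of_bounded {D D' : ℝ → ℂ} {C : ℝ} (hD : HasWeakDeriv D D') (hC : ∀ᵐ x, ‖D x‖ ≤ C)
    (hD' : MemH n D') (hf : MemH n f) : MemH n fun x => D x * f x := by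
  induction n generalizing f with
  | zero => exact MemLp.bounded_mul hD.locallyIntegrable.aestronglyMeasurable hC hf
  | succ n ih =>
    have h1 := (hD'.mul hf).of_succ
    obtain ⟨h, u, hu, hun⟩ := hf
    exact ⟨h.bounded_mul hD.locallyIntegrable.aestronglyMeasurable hC, _, hD.mul hu,
      h1.add (ih hD'.of_succ hun)⟩

end MemH

end Sobolev

noncomputable section

/-! ### Estimates for the kernel `exp (-|x - y|)`. -/

section Kernel

theorem integral_exp_neg_mul_abs {a : ℝ} (ha : 0 < a) : ∫ y, Real.exp (-a * |y|) = 2 / a := by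
  have := integral_comp_abs (f := fun y => Real.exp (-a * y))
  rw [this, integral_exp_mul_Ioi (neg_lt_zero.2 ha)]
  simp
  ring

theorem integral_exp_neg_mul_abs_sub {a : ℝ} (ha : 0 < a) (x : ℝ) :
    ∫ y, Real.exp (-a * |x - y|) = 2 / a := by
  rw [integral_sub_left_eq_self (fun y => Real.exp (-a * |y|)) volume x]
  exact integral_exp_neg_mul_abs ha

theorem integrable_exp_neg_mul_abs_sub {a : ℝ} (ha : 0 < a) (x : ℝ) :
    Integrable fun y => Real.exp (-a * |x - y|) := by
  by_contra h
  have h1 := integral_exp_neg_mul_abs_sub ha x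
  rw [integral_undef h] at h1
  exact (div_pos two_pos ha).ne h1

theorem integral_mul_le_of_integral_sq_le {f g : ℝ → ℝ} {A B : ℝ} (hf : MemLp f 2)
    (hg : MemLp g 2) (hf0 : ∀ x, 0 ≤ f x) (hg0 : ∀ x, 0 ≤ g x) (hA : 0 ≤ A) (hB : 0 ≤ B)
    (hfA : ∫ x, f x ^ 2 ≤ A ^ 2) (hgB : ∫ x, g x ^ 2 ≤ B ^ 2) : ∫ x, f x * g x ≤ A * B := by
  have h2 : ENNReal.ofReal 2 = 2 := by simp
  have h := integral_mul_le_Lp_mul_Lq_of_nonneg Real.HolderConjugate.two_two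
    (Eventually.of_forall hf0) (Eventually.of_forall hg0) (h2 ▸ hf) (h2 ▸ hg)
  simp only [Real.rpow_two, ← Real.sqrt_eq_rpow] at h
  refine h.trans ?_
  gcongr
  · exact (Real.sqrt_le_left hA).2 hfA
  · exact (Real.sqrt_le_left hB).2 hgB

theorem memLp_exp_neg_abs_sub (x : ℝ) : MemLp (fun y => Real.exp (-|x - y|)) 2 := by
  rw [memLp_two_iff_integrable_sq (by fun_prop)]
  refine (integrable_exp_neg_mul_abs_sub two_pos x).congr (Eventually.of_forall fun y => ?_)
  simp only
  rw [← Real.exp_nat_mul]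
  congr 1; push_cast; ring

theorem integrable_exp_neg_abs_sub (x : ℝ) : Integrable fun y => Real.exp (-|x - y|) := by
  simpa using integrable_exp_neg_mul_abs_sub one_pos x

theorem integral_exp_neg_abs_sub (x : ℝ) : ∫ y, Real.exp (-|x - y|) = 2 := by
  simpa using integral_exp_neg_mul_abs_sub one_pos x

theorem integral_exp_neg_abs_sub_sq (x : ℝ) : ∫ y, Real.exp (-|x - y|) ^ 2 = 1 := by
  have := integral_exp_neg_mul_abs_sub two_pos x
  rw [div_self two_ne_zero] at this
  rw [← this]
  congr 1; ext y
  rw [← Real.exp_nat_mul]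
  congr 1; push_cast; ring

variable {p : ℝ → ℂ} {δ α β : ℝ}

theorem integrable_kernel (hp : MemLp p 2) (α β x : ℝ) :
    Integrable fun y => Real.exp (-|x - y|) * (α + β * ‖p y‖) := by
  have h1 : Integrable fun y => Real.exp (-|x - y|) * ‖p y‖ :=
    (memLp_exp_neg_abs_sub x).integrable_mul hp.norm
  refine (((integrable_exp_neg_abs_sub x).const_mul α).add (h1.const_mul β)).congr
    (Eventually.of_forall fun y => ?_)
  simp only [Pi.add_apply]; ring

/-- The kernel has `L¹` norm `2` and `L²` norm `1`; Cauchy-Schwarz handles the second term. The form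
`α + β ‖p‖` is that of every bound on the Riccati nonlinearity. -/
theorem integral_kernel_le (hp : MemLp p 2) (hδ0 : 0 ≤ δ) (hδ : ∫ x, ‖p x‖ ^ 2 ≤ δ ^ 2)
    (hβ : 0 ≤ β) (α x : ℝ) :
    ∫ y, Real.exp (-|x - y|) * (α + β * ‖p y‖) ≤ 2 * α + β * δ := by
  have h1 : Integrable fun y => Real.exp (-|x - y|) * ‖p y‖ :=
    (memLp_exp_neg_abs_sub x).integrable_mul hp.norm
  have h2 : ∫ y, Real.exp (-|x - y|) * (α + β * ‖p y‖) =
      ∫ y, (α * Real.exp (-|x - y|) + β * (Real.exp (-|x - y|) * ‖p y‖)) := by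
    congr 1; ext y; ring
  rw [h2, integral_add ((integrable_exp_neg_abs_sub x).const_mul α) (h1.const_mul β),
    integral_const_mul, integral_const_mul, integral_exp_neg_abs_sub]
  have h3 := integral_mul_le_of_integral_sq_le (memLp_exp_neg_abs_sub x) hp.norm
    (fun _ => (Real.exp_pos _).le) (fun _ => norm_nonneg _) zero_le_one hδ0
    (by rw [integral_exp_neg_abs_sub_sq, one_pow]) hδ
  nlinarith

end Kernel

/-! ### The linearised equation and its solvability condition. -/

section Green

/-- The hyperbolic secant. -/
def sech (x : ℝ) : ℝ := (Real.cosh x)⁻¹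

theorem sech_pos (x : ℝ) : 0 < sech x := inv_pos.2 (Real.cosh_pos x)

theorem continuous_sech : Continuous sech :=
  Real.continuous_cosh.inv₀ fun x => (Real.cosh_pos x).ne'

theorem sech_le_one (x : ℝ) : sech x ≤ 1 := inv_le_one_of_one_le₀ (Real.one_le_cosh x)

theorem sech_le (x : ℝ) : sech x ≤ 2 * Real.exp (-|x|) := by
  rw [sech, inv_le_comm₀ (Real.cosh_pos x) (by positivity), mul_inv, ← Real.exp_neg, neg_neg,
    ← Real.cosh_abs, Real.cosh_eq]
  linarith [Real.exp_pos (-|x|)]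

/-- The unique bounded solution `t` of `t' = t tanh x - m sech x + g`. -/
def greenOp (g : ℝ → ℂ) (x : ℝ) : ℂ :=
  (Real.exp (-x) / 2 : ℝ) * (∫ y in Iic x, (sech y : ℂ) * g y) -
    (Real.exp x / 2 : ℝ) * ∫ y in Ioi x, (sech y : ℂ) * g y

/-- The multiplier `m` of the solvability condition `∫ (g - m sech) sech = 0`. -/
def greenMean (g : ℝ → ℂ) : ℂ := (1 / 2 : ℂ) * ∫ y, (sech y : ℂ) * g y

variable {p g h : ℝ → ℂ} {δ α β : ℝ}

theorem integrable_sech_mul (hp : MemLp p 2) (hg : AEStronglyMeasurable g)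
    (hgp : ∀ y, ‖g y‖ ≤ α + β * ‖p y‖) : Integrable fun y => (sech y : ℂ) * g y := by
  refine ((integrable_kernel hp α β 0).const_mul 2).mono'
    ((Complex.continuous_ofReal.comp continuous_sech).aestronglyMeasurable.mul hg)
    (Eventually.of_forall fun y => ?_)
  rw [norm_mul, Complex.norm_real, Real.norm_of_nonneg (sech_pos y).le, zero_sub, abs_neg,
    ← mul_assoc]
  have := sech_le y
  have := hgp y
  gcongr

theorem norm_greenMean_le (hp : MemLp p 2) (hδ0 : 0 ≤ δ) (hδ : ∫ x, ‖p x‖ ^ 2 ≤ δ ^ 2)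
    (hβ : 0 ≤ β) (hgp : ∀ y, ‖g y‖ ≤ α + β * ‖p y‖) :
    ‖greenMean g‖ ≤ 2 * α + β * δ := by
  refine le_trans ?_ (integral_kernel_le hp hδ0 hδ hβ α 0)
  rw [greenMean, ← integral_const_mul]
  refine norm_integral_le_of_norm_le (integrable_kernel hp α β 0) (Eventually.of_forall fun y => ?_)
  rw [norm_mul, norm_mul, Complex.norm_real, Real.norm_of_nonneg (sech_pos y).le, zero_sub,
    abs_neg, ← mul_assoc]
  have h1 := sech_le y
  have h2 := hgp y
  gcongr
  norm_num
  linarith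

/-- On either side of `x`, the prefactor `exp (∓x)` times `exp (-|y|)` is at most `exp (-|x - y|)`,
so both halves are dominated by the same kernel. -/
theorem norm_greenOp_le (hp : MemLp p 2) (hδ0 : 0 ≤ δ) (hδ : ∫ x, ‖p x‖ ^ 2 ≤ δ ^ 2)
    (hβ : 0 ≤ β) (hgp : ∀ y, ‖g y‖ ≤ α + β * ‖p y‖) (x : ℝ) :
    ‖greenOp g x‖ ≤ 2 * α + β * δ := by
  refine le_trans ?_ (integral_kernel_le hp hδ0 hδ hβ α x)
  have hi := integrable_kernel hp α β x
  rw [← intervalIntegral.integral_Iic_add_Ioi (b := x) hi.integrableOn hi.integrableOn]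
  refine (norm_sub_le _ _).trans (add_le_add ?_ ?_)
  · rw [← integral_const_mul]
    refine norm_integral_le_of_norm_le hi.integrableOn ?_
    refine (ae_restrict_mem measurableSet_Iic).mono fun y hy => ?_
    have hy' : y ≤ x := hy
    rw [norm_mul, norm_mul, Complex.norm_real, Complex.norm_real,
      Real.norm_of_nonneg (sech_pos y).le, Real.norm_of_nonneg (by positivity), ← mul_assoc]
    have h2 := hgp y
    gcongr
    calc Real.exp (-x) / 2 * sech y ≤ Real.exp (-x) / 2 * (2 * Real.exp (-|y|)) := by
          gcongr; exact sech_le y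
      _ = Real.exp (-x + -|y|) := by rw [Real.exp_add]; ring
      _ ≤ Real.exp (-|x - y|) := by
          rw [abs_of_nonneg (sub_nonneg.2 hy')]
          exact Real.exp_le_exp.2 (by linarith [neg_abs_le y])
  · rw [← integral_const_mul]
    refine norm_integral_le_of_norm_le hi.integrableOn ?_
    refine (ae_restrict_mem measurableSet_Ioi).mono fun y hy => ?_
    have hy' : x < y := hy
    rw [norm_mul, norm_mul, Complex.norm_real, Complex.norm_real,
      Real.norm_of_nonneg (sech_pos y).le, Real.norm_of_nonneg (by positivity), ← mul_assoc]
    have h2 := hgp y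
    gcongr
    calc Real.exp x / 2 * sech y ≤ Real.exp x / 2 * (2 * Real.exp (-|y|)) := by
          gcongr; exact sech_le y
      _ = Real.exp (x + -|y|) := by rw [Real.exp_add]; ring
      _ ≤ Real.exp (-|x - y|) := by
          rw [abs_of_neg (sub_neg.2 hy')]
          exact Real.exp_le_exp.2 (by linarith [le_abs_self y])

theorem greenOp_sub (hg : Integrable fun y => (sech y : ℂ) * g y)
    (hh : Integrable fun y => (sech y : ℂ) * h y) (x : ℝ) :
    greenOp g x - greenOp h x = greenOp (fun y => g y - h y) x := by
  simp only [greenOp, mul_sub]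
  rw [integral_sub hg.integrableOn hh.integrableOn, integral_sub hg.integrableOn hh.integrableOn]
  ring

theorem greenMean_sub (hg : Integrable fun y => (sech y : ℂ) * g y)
    (hh : Integrable fun y => (sech y : ℂ) * h y) :
    greenMean g - greenMean h = greenMean (fun y => g y - h y) := by
  simp only [greenMean, mul_sub]
  rw [integral_sub hg hh]
  ring

/-- With `K` the full integral of `sech · g`, the operator equals `cosh x ∫_{-∞}^x sech g - (exp x /
2) K`. The first term is variation of constants; the second cancels the growth at `+∞`. Since `exp x
(1 - tanh x) = sech x`, it costs exactly the source `-(K / 2) sech x`. -/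
theorem hasACDeriv_greenOp (hg : Integrable fun y => (sech y : ℂ) * g y) :
    HasACDeriv (greenOp g) fun x =>
      (Real.tanh x : ℂ) * greenOp g x - greenMean g * sech x + g x := by
  set I : ℂ := ∫ y in Iic (0 : ℝ), (sech y : ℂ) * g y
  have hI : HasACDeriv (fun x => ∫ y in Iic x, (sech y : ℂ) * g y)
      (fun y => (sech y : ℂ) * g y) := by
    have h1 := ((HasACDeriv.const I).add
      (HasACDeriv.integral_of_locallyIntegrable hg.locallyIntegrable 0)).of_eq_deriv
        fun x => zero_add _
    convert h1 using 2 with x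
    have := intervalIntegral.integral_Iic_sub_Iic (a := 0) (b := x) (μ := volume)
      hg.integrableOn hg.integrableOn
    rw [← this]; ring
  have hI' : ∀ x, (∫ y in Ioi x, (sech y : ℂ) * g y) =
      (∫ y, (sech y : ℂ) * g y) - ∫ y in Iic x, (sech y : ℂ) * g y := fun x => by
    rw [← intervalIntegral.integral_Iic_add_Ioi (b := x) hg.integrableOn hg.integrableOn]
    ring
  have he : HasACDeriv (fun x : ℝ => ((Real.exp x / 2 : ℝ) : ℂ))
      (fun x : ℝ => ((Real.exp x / 2 : ℝ) : ℂ)) :=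
    (HasACDeriv.of_hasDerivAt (fun x => (Real.hasDerivAt_exp x).div_const 2) (by fun_prop)).ofReal
  have he' : HasACDeriv (fun x : ℝ => ((Real.exp (-x) / 2 : ℝ) : ℂ))
      (fun x : ℝ => ((-Real.exp (-x) / 2 : ℝ) : ℂ)) := by
    refine (HasACDeriv.of_hasDerivAt (fun x => ?_) (by fun_prop)).ofReal
    have := ((hasDerivAt_neg x).exp).div_const 2
    simpa using this
  have key := (he'.mul hI).sub (he.mul ((HasACDeriv.const (∫ y, (sech y : ℂ) * g y)).sub hI))
  have heq : greenOp g = fun x => ((Real.exp (-x) / 2 : ℝ) : ℂ) *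
      (∫ y in Iic x, (sech y : ℂ) * g y) - ((Real.exp x / 2 : ℝ) : ℂ) *
        ((∫ y, (sech y : ℂ) * g y) - ∫ y in Iic x, (sech y : ℂ) * g y) := by
    funext x
    rw [← hI', greenOp]
  rw [heq]
  refine key.of_eq_deriv fun x => ?_
  simp only [greenMean]
  generalize (∫ y in Iic x, (sech y : ℂ) * g y) = J
  generalize (∫ y, (sech y : ℂ) * g y) = K
  have hc : (Real.cosh x : ℂ) ≠ 0 := by exact_mod_cast (Real.cosh_pos x).ne'
  have e1 : ((Real.exp x : ℝ) : ℂ) = Real.cosh x + Real.sinh x := by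
    rw [← Complex.ofReal_add, Real.cosh_add_sinh]
  have e2 : ((Real.exp (-x) : ℝ) : ℂ) = Real.cosh x - Real.sinh x := by
    rw [← Complex.ofReal_sub, Real.cosh_sub_sinh]
  have e3 : (Real.cosh x : ℂ) ^ 2 = Real.sinh x ^ 2 + 1 := by
    exact_mod_cast Real.cosh_sq x
  rw [sech, Real.tanh_eq_sinh_div_cosh]
  simp only [Complex.ofReal_div, Complex.ofReal_neg, Complex.ofReal_inv, Complex.ofReal_ofNat, e1,
    e2]
  generalize (Real.cosh x : ℂ) = c at *
  generalize (Real.sinh x : ℂ) = s at *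
  field_simp
  linear_combination (-K) * e3

end Green

/-! ### The rotating orthonormal frame of the soliton eigenvector. -/

section Frame

/-- The cosine of the angle of the soliton eigenvector. -/
def frameCos (x : ℝ) : ℝ := Real.exp (-x / 2) / √(2 * Real.cosh x)

/-- The sine of the angle of the soliton eigenvector. -/
def frameSin (x : ℝ) : ℝ := Real.exp (x / 2) / √(2 * Real.cosh x)

theorem sq_sqrt_two_cosh (x : ℝ) : √(2 * Real.cosh x) ^ 2 = 2 * Real.cosh x :=
  Real.sq_sqrt (by linarith [Real.cosh_pos x])

theorem sqrt_two_cosh_pos (x : ℝ) : 0 < √(2 * Real.cosh x) :=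
  Real.sqrt_pos.2 (by linarith [Real.cosh_pos x])

theorem frameCos_sq (x : ℝ) : frameCos x ^ 2 = Real.exp (-x) / (2 * Real.cosh x) := by
  rw [frameCos, div_pow, sq_sqrt_two_cosh, ← Real.exp_nat_mul]
  congr 2; push_cast; ring

theorem frameSin_sq (x : ℝ) : frameSin x ^ 2 = Real.exp x / (2 * Real.cosh x) := by
  rw [frameSin, div_pow, sq_sqrt_two_cosh, ← Real.exp_nat_mul]
  congr 2; push_cast; ring

theorem frameSin_sq_add_frameCos_sq (x : ℝ) : frameSin x ^ 2 + frameCos x ^ 2 = 1 := by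
  have := Real.cosh_pos x
  rw [frameCos_sq, frameSin_sq, ← Real.cosh_add_sinh, ← Real.cosh_sub_sinh]
  field_simp
  ring

theorem frameSin_sq_sub_frameCos_sq (x : ℝ) : frameSin x ^ 2 - frameCos x ^ 2 = Real.tanh x := by
  have := Real.cosh_pos x
  rw [frameCos_sq, frameSin_sq, ← Real.cosh_add_sinh, ← Real.cosh_sub_sinh,
    Real.tanh_eq_sinh_div_cosh]
  field_simp
  ring

theorem two_mul_frameCos_mul_frameSin (x : ℝ) : 2 * frameCos x * frameSin x = sech x := by
  have := Real.cosh_pos x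
  have h1 : Real.exp (-x / 2) * Real.exp (x / 2) = 1 := by
    rw [← Real.exp_add]; simp; ring
  have h2 := sq_sqrt_two_cosh x
  have h3 := sqrt_two_cosh_pos x
  rw [frameCos, frameSin, sech, mul_assoc, div_mul_div_comm, h1, ← sq, h2]
  field_simp

theorem hasDerivAt_sqrt_two_cosh (x : ℝ) :
    HasDerivAt (fun x => √(2 * Real.cosh x)) (Real.sinh x / √(2 * Real.cosh x)) x := by
  have := ((Real.hasDerivAt_cosh x).const_mul 2).sqrt (by linarith [Real.cosh_pos x])
  convert this using 1
  field_simp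

/-- The frame turns at angular speed `sech / 2 = c s`. Writing the derivative as a polynomial in `c`
and `s` reduces later checks to algebra modulo `s² + c² = 1`. -/
theorem hasDerivAt_frameCos (x : ℝ) :
    HasDerivAt frameCos (-(frameSin x ^ 2 * frameCos x)) x := by
  have h1 : HasDerivAt (fun x : ℝ => Real.exp (-x / 2)) (Real.exp (-x / 2) * (-1 / 2)) x :=
    ((hasDerivAt_neg x).div_const 2).exp
  have h := h1.div (hasDerivAt_sqrt_two_cosh x) (sqrt_two_cosh_pos x).ne'
  refine HasDerivAt.congr_deriv (f := frameCos) h ?_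
  rw [frameSin_sq, ← Real.cosh_add_sinh x, frameCos]
  have h2 := sq_sqrt_two_cosh x
  have h3 := sqrt_two_cosh_pos x
  generalize √(2 * Real.cosh x) = w at *
  have h4 : Real.cosh x = w ^ 2 / 2 := by linarith
  rw [h4]
  field_simp
  ring

theorem hasDerivAt_frameSin (x : ℝ) :
    HasDerivAt frameSin (frameSin x * frameCos x ^ 2) x := by
  have h1 : HasDerivAt (fun x : ℝ => Real.exp (x / 2)) (Real.exp (x / 2) * (1 / 2)) x :=
    ((hasDerivAt_id x).div_const 2).exp
  have h := h1.div (hasDerivAt_sqrt_two_cosh x) (sqrt_two_cosh_pos x).ne'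
  refine HasDerivAt.congr_deriv (f := frameSin) h ?_
  rw [frameCos_sq, ← Real.cosh_sub_sinh x, frameSin]
  have h2 := sq_sqrt_two_cosh x
  have h3 := sqrt_two_cosh_pos x
  generalize √(2 * Real.cosh x) = w at *
  have h4 : Real.cosh x = w ^ 2 / 2 := by linarith
  rw [h4]
  field_simp

theorem continuous_frameCos : Continuous frameCos :=
  continuous_iff_continuousAt.2 fun x => (hasDerivAt_frameCos x).continuousAt

theorem continuous_frameSin : Continuous frameSin :=
  continuous_iff_continuousAt.2 fun x => (hasDerivAt_frameSin x).continuousAt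

theorem hasACDeriv_frameCos : HasACDeriv (fun x => (frameCos x : ℂ))
    fun x => -((frameSin x : ℂ) ^ 2 * frameCos x) := by
  have h := (HasACDeriv.of_hasDerivAt hasDerivAt_frameCos
    (((continuous_frameSin.pow 2).mul continuous_frameCos).neg)).ofReal
  exact h.of_eq_deriv fun x => by push_cast; rfl

theorem hasACDeriv_frameSin : HasACDeriv (fun x => (frameSin x : ℂ))
    fun x => (frameSin x : ℂ) * frameCos x ^ 2 := by
  have h := (HasACDeriv.of_hasDerivAt hasDerivAt_frameSin
    (continuous_frameSin.mul (continuous_frameCos.pow 2))).ofReal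
  exact h.of_eq_deriv fun x => by push_cast; rfl

end Frame

/-! ### The Riccati equation, solved by contraction. -/

section Riccati

/-- The part of the Riccati equation that is nonlinear in `(p, t, μ)`, or linear in `p`, in terms of
the values `c, s` of the frame. -/
def riccatiForm (c s : ℝ) (p t μ : ℂ) : ℂ :=
  (p * s ^ 2 + conj p * c ^ 2) +
    t * (2 * μ * (s ^ 2 - c ^ 2) + (p - conj p) * (2 * c * s)) +
    t ^ 2 * ((1 + μ) * (2 * c * s) + (p * c ^ 2 + conj p * s ^ 2))

variable {c s : ℝ}

theorem norm_mul_sq_add_conj_mul_sq_le (h : s ^ 2 + c ^ 2 = 1) (p : ℂ) :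
    ‖p * s ^ 2 + conj p * c ^ 2‖ ≤ ‖p‖ := by
  refine (norm_add_le _ _).trans ?_
  rw [norm_mul, norm_mul, RCLike.norm_conj, norm_pow, norm_pow, Complex.norm_real,
    Complex.norm_real, ← mul_add, Real.norm_eq_abs, Real.norm_eq_abs, sq_abs, sq_abs, h, mul_one]

theorem norm_sq_sub_sq_le (h : s ^ 2 + c ^ 2 = 1) : ‖(s ^ 2 - c ^ 2 : ℂ)‖ ≤ 1 := by
  rw [← Complex.ofReal_pow, ← Complex.ofReal_pow, ← Complex.ofReal_sub, Complex.norm_real,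
    Real.norm_eq_abs, abs_le]
  constructor <;> nlinarith [sq_nonneg s, sq_nonneg c]

theorem norm_two_mul_mul_le (h : s ^ 2 + c ^ 2 = 1) : ‖(2 * c * s : ℂ)‖ ≤ 1 := by
  have : (2 * c * s : ℂ) = ((2 * c * s : ℝ) : ℂ) := by push_cast; rfl
  rw [this, Complex.norm_real, Real.norm_eq_abs, abs_le]
  constructor <;> nlinarith [sq_nonneg (s + c), sq_nonneg (s - c)]

theorem norm_sub_conj_le (p : ℂ) : ‖p - conj p‖ ≤ 2 * ‖p‖ := by
  refine (norm_sub_le _ _).trans ?_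
  rw [RCLike.norm_conj]; linarith

theorem norm_riccatiForm_le (h : s ^ 2 + c ^ 2 = 1) {p t μ : ℂ} {T m : ℝ} (ht : ‖t‖ ≤ T)
    (hμ : ‖μ‖ ≤ m) :
    ‖riccatiForm c s p t μ‖ ≤ (2 * T * m + T ^ 2 * (1 + m)) + (1 + 2 * T + T ^ 2) * ‖p‖ := by
  have hT : 0 ≤ T := (norm_nonneg _).trans ht
  have hm : 0 ≤ m := (norm_nonneg _).trans hμ
  have h1 := norm_mul_sq_add_conj_mul_sq_le h p
  have h1' : ‖p * c ^ 2 + conj p * s ^ 2‖ ≤ ‖p‖ :=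
    norm_mul_sq_add_conj_mul_sq_le ((add_comm _ _).trans h) p
  have h2 := norm_sq_sub_sq_le h
  have h3 := norm_two_mul_mul_le h
  have h4 := norm_sub_conj_le p
  have h5 : ‖1 + μ‖ ≤ 1 + m := (norm_add_le _ _).trans (by rw [norm_one]; linarith)
  calc ‖riccatiForm c s p t μ‖
      ≤ ‖p * s ^ 2 + conj p * c ^ 2‖ + ‖t‖ * (2 * ‖μ‖ * ‖(s ^ 2 - c ^ 2 : ℂ)‖ +
          ‖p - conj p‖ * ‖(2 * c * s : ℂ)‖) + ‖t‖ ^ 2 * (‖1 + μ‖ * ‖(2 * c * s : ℂ)‖ +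
          ‖p * c ^ 2 + conj p * s ^ 2‖) := by
        refine norm_add₃_le.trans ?_
        rw [norm_mul, norm_mul, norm_pow]
        gcongr
        · refine (norm_add_le _ _).trans ?_
          rw [norm_mul, norm_mul, norm_mul (p - conj p)]
          simp
        · refine (norm_add_le _ _).trans ?_
          rw [norm_mul]
    _ ≤ ‖p‖ + T * (2 * m * 1 + (2 * ‖p‖) * 1) + T ^ 2 * ((1 + m) * 1 + ‖p‖) := by gcongr
    _ = _ := by ring

/-- The part linear in `p` alone cancels in the difference. Every remaining term carries a factor
`R` or `‖p‖`, which is the smallness needed to contract. -/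
theorem norm_riccatiForm_sub_le (h : s ^ 2 + c ^ 2 = 1) {p t μ t' μ' : ℂ} {R d : ℝ} (hR : R ≤ 1)
    (ht : ‖t‖ ≤ R) (hμ : ‖μ‖ ≤ R) (ht' : ‖t'‖ ≤ R) (htd : ‖t - t'‖ ≤ d)
    (hμd : ‖μ - μ'‖ ≤ d) :
    ‖riccatiForm c s p t μ - riccatiForm c s p t' μ'‖ ≤ 9 * R * d + 4 * d * ‖p‖ := by
  have hR0 : 0 ≤ R := (norm_nonneg _).trans ht
  have hd0 : 0 ≤ d := (norm_nonneg _).trans htd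
  have h1' : ‖p * c ^ 2 + conj p * s ^ 2‖ ≤ ‖p‖ :=
    norm_mul_sq_add_conj_mul_sq_le ((add_comm _ _).trans h) p
  have h2 := norm_sq_sub_sq_le h
  have h3 := norm_two_mul_mul_le h
  have h4 := norm_sub_conj_le p
  have h5 : ‖1 + μ‖ ≤ 2 := (norm_add_le _ _).trans (by rw [norm_one]; linarith)
  have h6 : ‖t + t'‖ ≤ 2 * R := (norm_add_le _ _).trans (by linarith)
  have e : riccatiForm c s p t μ - riccatiForm c s p t' μ' =
      2 * ((t - t') * μ * (s ^ 2 - c ^ 2)) + 2 * (t' * (μ - μ') * (s ^ 2 - c ^ 2)) +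
      (t - t') * ((p - conj p) * (2 * c * s)) +
      (t - t') * (t + t') * ((1 + μ) * (2 * c * s)) + t' ^ 2 * ((μ - μ') * (2 * c * s)) +
      (t - t') * (t + t') * (p * c ^ 2 + conj p * s ^ 2) := by
    simp only [riccatiForm]; ring
  rw [e]
  calc _ ≤ 2 * (‖t - t'‖ * ‖μ‖ * ‖(s ^ 2 - c ^ 2 : ℂ)‖) +
      2 * (‖t'‖ * ‖μ - μ'‖ * ‖(s ^ 2 - c ^ 2 : ℂ)‖) +
      ‖t - t'‖ * (‖p - conj p‖ * ‖(2 * c * s : ℂ)‖) +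
      ‖t - t'‖ * ‖t + t'‖ * (‖1 + μ‖ * ‖(2 * c * s : ℂ)‖) +
      ‖t'‖ ^ 2 * (‖μ - μ'‖ * ‖(2 * c * s : ℂ)‖) +
      ‖t - t'‖ * ‖t + t'‖ * ‖p * c ^ 2 + conj p * s ^ 2‖ := by
        refine (norm_add_le _ _).trans (add_le_add ?_ (by rw [norm_mul, norm_mul]))
        refine (norm_add_le _ _).trans (add_le_add ?_ (by rw [norm_mul, norm_pow, norm_mul]))
        refine (norm_add_le _ _).trans
          (add_le_add ?_ (by rw [norm_mul, norm_mul, norm_mul (1 + μ)]))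
        refine (norm_add_le _ _).trans
          (add_le_add ?_ (by rw [norm_mul, norm_mul (p - conj p)]))
        refine (norm_add_le _ _).trans (add_le_add ?_ ?_)
        · rw [norm_mul, norm_mul, norm_mul]; simp
        · rw [norm_mul, norm_mul, norm_mul]; simp
    _ ≤ 2 * (d * R * 1) + 2 * (R * d * 1) + d * (2 * ‖p‖ * 1) + d * (2 * R) * (2 * 1) +
        R ^ 2 * (d * 1) + d * (2 * R) * ‖p‖ := by gcongr
    _ ≤ 9 * R * d + 4 * d * ‖p‖ := by
        have a1 : R ^ 2 * d ≤ R * d := by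
          have : R ^ 2 ≤ R := by nlinarith
          gcongr
        have a2 : R * (d * ‖p‖) ≤ 1 * (d * ‖p‖) := by gcongr
        nlinarith

/-- The nonlinear term of the Riccati equation. -/
def riccatiSource (p t : ℝ → ℂ) (μ : ℂ) (x : ℝ) : ℂ :=
  riccatiForm (frameCos x) (frameSin x) (p x) (t x) μ

theorem aestronglyMeasurable_riccatiSource {p t : ℝ → ℂ} (hp : AEStronglyMeasurable p)
    (ht : Continuous t) (μ : ℂ) : AEStronglyMeasurable (riccatiSource p t μ) := by
  have hc := (Complex.continuous_ofReal.comp continuous_frameCos).aestronglyMeasurable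
    (μ := (volume : Measure ℝ))
  have hs := (Complex.continuous_ofReal.comp continuous_frameSin).aestronglyMeasurable
    (μ := (volume : Measure ℝ))
  have ht' := ht.aestronglyMeasurable (μ := (volume : Measure ℝ))
  have hp' := Complex.continuous_conj.comp_aestronglyMeasurable hp
  exact ((hp.mul (hs.pow 2)).add (hp'.mul (hc.pow 2))).add
    (ht'.mul ((((hs.pow 2).sub (hc.pow 2)).const_mul (2 * μ)).add
      ((hp.sub hp').mul ((hc.const_mul 2).mul hs)))) |>.add
    ((ht'.pow 2).mul ((((hc.const_mul 2).mul hs).const_mul (1 + μ)).add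
      ((hp.mul (hc.pow 2)).add (hp'.mul (hs.pow 2)))))

/-- The unknown is the pair `(t, μ)`, iterated by `(greenOp N, greenMean N)`. At a fixed point the
multiplier produced by the Green operator is `μ` itself, so the solvability condition is built in.
-/
theorem exists_riccati_solution {p : ℝ → ℂ} {δ : ℝ} (hp : MemLp p 2) (hδ0 : 0 ≤ δ)
    (hδ1 : δ ≤ 1 / 200) (hδ : ∫ x, ‖p x‖ ^ 2 ≤ δ ^ 2) :
    ∃ (t : ℝ → ℂ) (μ : ℂ), (∀ x, ‖t x‖ ≤ 2 * δ) ∧ ‖μ‖ ≤ 2 * δ ∧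
      HasACDeriv t fun x => (Real.tanh x : ℂ) * t x - μ * sech x + riccatiSource p t μ x := by
  open BoundedContinuousFunction in
  have hfr := frameSin_sq_add_frameCos_sq
  have hbound : ∀ u : (ℝ →ᵇ ℂ) × ℂ, ∀ y, ‖riccatiSource p u.1 u.2 y‖ ≤
      (2 * ‖u.1‖ * ‖u.2‖ + ‖u.1‖ ^ 2 * (1 + ‖u.2‖)) + (1 + 2 * ‖u.1‖ + ‖u.1‖ ^ 2) * ‖p y‖ :=
    fun u y => norm_riccatiForm_le (hfr y) (u.1.norm_coe_le_norm y) le_rfl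
  have hint : ∀ u : (ℝ →ᵇ ℂ) × ℂ,
      Integrable fun y => (sech y : ℂ) * riccatiSource p u.1 u.2 y := fun u =>
    integrable_sech_mul hp (aestronglyMeasurable_riccatiSource hp.1 u.1.continuous u.2) (hbound u)
  let Φ : (ℝ →ᵇ ℂ) × ℂ → (ℝ →ᵇ ℂ) × ℂ := fun u =>
    (BoundedContinuousFunction.ofNormedAddCommGroup (greenOp (riccatiSource p u.1 u.2))
      (hasACDeriv_greenOp (hint u)).continuous _
      (norm_greenOp_le hp hδ0 hδ (by positivity) (hbound u)),
      greenMean (riccatiSource p u.1 u.2))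
  have hball : ∀ u : (ℝ →ᵇ ℂ) × ℂ, u ∈ Metric.closedBall (0 : (ℝ →ᵇ ℂ) × ℂ) (2 * δ) →
      ‖u.1‖ ≤ 2 * δ ∧ ‖u.2‖ ≤ 2 * δ := fun u hu => by
    rw [mem_closedBall_zero_iff] at hu
    exact ⟨(norm_fst_le u).trans hu, (norm_snd_le u).trans hu⟩
  have hmaps : MapsTo Φ (Metric.closedBall 0 (2 * δ)) (Metric.closedBall 0 (2 * δ)) := by
    intro u hu
    obtain ⟨h1, h2⟩ := hball u hu
    have hb : ∀ y, ‖riccatiSource p u.1 u.2 y‖ ≤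
        (2 * (2 * δ) * (2 * δ) + (2 * δ) ^ 2 * (1 + 2 * δ)) +
          (1 + 2 * (2 * δ) + (2 * δ) ^ 2) * ‖p y‖ := fun y =>
      norm_riccatiForm_le (hfr y) ((u.1.norm_coe_le_norm y).trans h1) h2
    -- The term linear in `p` contributes `δ`, and the quadratic remainder is far below another `δ`
    -- when `δ ≤ 1/200`; hence the radius `2δ`.
    have hle : 2 * (2 * (2 * δ) * (2 * δ) + (2 * δ) ^ 2 * (1 + 2 * δ)) +
        (1 + 2 * (2 * δ) + (2 * δ) ^ 2) * δ ≤ 2 * δ := by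
      have : (2 * (2 * (2 * δ) * (2 * δ) + (2 * δ) ^ 2 * (1 + 2 * δ)) +
        (1 + 2 * (2 * δ) + (2 * δ) ^ 2) * δ) = δ * (1 + 28 * δ + 20 * δ ^ 2) := by ring
      rw [this, mul_comm 2 δ]
      gcongr
      nlinarith
    rw [mem_closedBall_zero_iff, Prod.norm_def, max_le_iff]
    refine ⟨(BoundedContinuousFunction.norm_le (by positivity)).2 fun x => ?_, ?_⟩
    · exact (norm_greenOp_le hp hδ0 hδ (by positivity) hb x).trans hle
    · exact (norm_greenMean_le hp hδ0 hδ (by positivity) hb).trans hle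
  have hcontr : ContractingWith (1 / 2) (hmaps.restrict Φ _ _) := by
    refine ⟨by norm_num, LipschitzWith.of_dist_le_mul fun u v => ?_⟩
    obtain ⟨h1, h2⟩ := hball u.1 u.2
    obtain ⟨h3, h4⟩ := hball v.1 v.2
    have hd : dist u v = dist u.1 v.1 := rfl
    have hd' : dist (hmaps.restrict Φ _ _ u) (hmaps.restrict Φ _ _ v) = dist (Φ u.1) (Φ v.1) := rfl
    rw [hd, hd']
    set d := dist u.1 v.1 with hdd
    have hd1 : ‖u.1.1 - v.1.1‖ ≤ d := by
      rw [hdd, dist_eq_norm]; exact norm_fst_le (u.1 - v.1)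
    have hd2 : ‖u.1.2 - v.1.2‖ ≤ d := by
      rw [hdd, dist_eq_norm]; exact norm_snd_le (u.1 - v.1)
    have hd0 : 0 ≤ d := dist_nonneg
    have hb : ∀ y, ‖riccatiSource p u.1.1 u.1.2 y - riccatiSource p v.1.1 v.1.2 y‖ ≤
        9 * (2 * δ) * d + 4 * d * ‖p y‖ := fun y =>
      norm_riccatiForm_sub_le (hfr y) (by linarith) ((u.1.1.norm_coe_le_norm y).trans h1) h2
        ((v.1.1.norm_coe_le_norm y).trans h3)
        (((u.1.1 - v.1.1).norm_coe_le_norm y).trans hd1) hd2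
    -- The Lipschitz constant is `40 δ ≤ 1/5`.
    have hle : 2 * (9 * (2 * δ) * d) + 4 * d * δ ≤ 1 / 2 * d := by nlinarith
    rw [dist_eq_norm, Prod.norm_def, max_le_iff]
    push_cast
    refine ⟨(BoundedContinuousFunction.norm_le (by positivity)).2 fun x => ?_, ?_⟩
    · have := greenOp_sub (hint u.1) (hint v.1) x
      change ‖greenOp (riccatiSource p u.1.1 u.1.2) x - greenOp (riccatiSource p v.1.1 v.1.2) x‖ ≤ _
      rw [this]
      exact (norm_greenOp_le hp hδ0 hδ (by positivity) hb x).trans hle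
    · have := greenMean_sub (hint u.1) (hint v.1)
      change ‖greenMean (riccatiSource p u.1.1 u.1.2) - greenMean (riccatiSource p v.1.1 v.1.2)‖ ≤ _
      rw [this]
      exact (norm_greenMean_le hp hδ0 hδ (by positivity) hb).trans hle
  obtain ⟨u, hu, hfix, -⟩ := hcontr.exists_fixedPoint' Metric.isClosed_closedBall.isComplete hmaps
    (x := 0) (Metric.mem_closedBall_self (by positivity)) (edist_ne_top _ _)
  obtain ⟨h1, h2⟩ := hball u hu
  refine ⟨u.1, u.2, fun x => (u.1.norm_coe_le_norm x).trans h1, h2, ?_⟩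
  have e1 : greenOp (riccatiSource p u.1 u.2) = u.1 :=
    congrArg (fun w : (ℝ →ᵇ ℂ) × ℂ => (w.1 : ℝ → ℂ)) hfix
  have e2 : greenMean (riccatiSource p u.1 u.2) = u.2 :=
    congrArg (fun w : (ℝ →ᵇ ℂ) × ℂ => w.2) hfix
  have key := hasACDeriv_greenOp (hint u)
  rwa [e1, e2] at key

end Riccati

/-! ### The `L²` bound on the Riccati solution. -/

section Energy

theorem ofReal_tanh_eq_frame (x : ℝ) :
    (Real.tanh x : ℂ) = (frameSin x : ℂ) ^ 2 - (frameCos x : ℂ) ^ 2 := by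
  rw [← frameSin_sq_sub_frameCos_sq]; push_cast; rfl

theorem ofReal_sech_eq_frame (x : ℝ) : (sech x : ℂ) = 2 * (frameCos x : ℂ) * (frameSin x : ℂ) := by
  rw [← two_mul_frameCos_mul_frameSin]; push_cast; rfl

theorem integrable_sech_sq : Integrable fun x => sech x ^ 2 := by
  refine ((memLp_exp_neg_abs_sub 0).integrable_sq.const_mul 4).mono'
    (continuous_sech.pow 2).aestronglyMeasurable (Eventually.of_forall fun x => ?_)
  have h1 := sech_le x
  have h2 := sech_pos x
  rw [norm_pow, Real.norm_of_nonneg h2.le, zero_sub, abs_neg]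
  calc sech x ^ 2 ≤ (2 * Real.exp (-|x|)) ^ 2 := by gcongr
    _ = _ := by ring

theorem integral_sech_sq_le : ∫ x, sech x ^ 2 ≤ 4 := by
  have h := integral_exp_neg_abs_sub_sq 0
  have : ∫ x, sech x ^ 2 ≤ ∫ x, 4 * Real.exp (-|0 - x|) ^ 2 := by
    refine integral_mono integrable_sech_sq
      ((memLp_exp_neg_abs_sub 0).integrable_sq.const_mul 4) fun x => ?_
    have h1 := sech_le x
    have h2 := sech_pos x
    simp only [zero_sub, abs_neg]
    calc sech x ^ 2 ≤ (2 * Real.exp (-|x|)) ^ 2 := by gcongr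
      _ = _ := by ring
  rw [integral_const_mul, h] at this
  linarith

variable {p t : ℝ → ℂ} {μ : ℂ} {δ : ℝ}

theorem norm_riccatiSource_le (hδ1 : δ ≤ 1 / 200) (ht : ∀ x, ‖t x‖ ≤ 2 * δ)
    (hμ : ‖μ‖ ≤ 2 * δ) (x : ℝ) :
    ‖riccatiSource p t μ x‖ ≤ ‖t x‖ / 16 + 2 * ‖p x‖ := by
  have h := norm_riccatiForm_le (frameSin_sq_add_frameCos_sq x) (p := p x) (le_refl ‖t x‖) hμ
  refine h.trans ?_
  have h1 := ht x
  have h0 := norm_nonneg (t x)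
  have a1 : ‖t x‖ ^ 2 ≤ ‖t x‖ * (1 / 100) := by rw [sq]; gcongr; linarith
  have a2 : ‖t x‖ * δ ≤ ‖t x‖ * (1 / 200) := by gcongr
  have a3 : ‖t x‖ ^ 2 * (1 + 2 * δ) ≤ ‖t x‖ * (1 / 100) * 2 := by
    refine mul_le_mul a1 (by linarith) (by linarith) (by positivity)
  have a4 : (1 + 2 * ‖t x‖ + ‖t x‖ ^ 2) ≤ 2 := by nlinarith
  have a5 := mul_le_mul_of_nonneg_right a4 (norm_nonneg (p x))
  linarith

/-- With `s² - c² = tanh` and `2cs = sech`, the expression inside `.re` is the derivative of `tanh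
|t|²`. It equals `(1 + tanh²) |t|² + 2 tanh Re (G t̄)`, and Young's inequality absorbs the cross
term into `|t|²`. -/
theorem sq_norm_le_energy {c s δ : ℝ} (h : s ^ 2 + c ^ 2 = 1) {t G : ℂ} {P : ℝ}
    (hG : ‖G‖ ≤ 2 * δ * (2 * c * s) + ‖t‖ / 16 + 2 * P) :
    ‖t‖ ^ 2 ≤ 2 * (4 * s ^ 2 * c ^ 2 * (t * conj t) + (s ^ 2 - c ^ 2 : ℂ) *
      (((s ^ 2 - c ^ 2 : ℂ) * t + G) * conj t + t * conj ((s ^ 2 - c ^ 2 : ℂ) * t + G))).re +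
      (64 * δ ^ 2 * (2 * c * s) ^ 2 + 32 * P ^ 2) := by
  have e : 4 * s ^ 2 * c ^ 2 * (t * conj t) + (s ^ 2 - c ^ 2 : ℂ) *
      (((s ^ 2 - c ^ 2 : ℂ) * t + G) * conj t + t * conj ((s ^ 2 - c ^ 2 : ℂ) * t + G)) =
      (((4 * s ^ 2 * c ^ 2 + 2 * (s ^ 2 - c ^ 2) ^ 2) * ‖t‖ ^ 2 : ℝ) : ℂ) +
        ((s ^ 2 - c ^ 2 : ℝ) : ℂ) * (G * conj t + conj (G * conj t)) := by
    have : t * conj t = ((‖t‖ ^ 2 : ℝ) : ℂ) := by rw [Complex.mul_conj']; push_cast; rfl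
    push_cast at this ⊢
    simp only [map_add, map_mul, map_sub, map_pow, Complex.conj_ofReal, Complex.conj_conj]
    linear_combination (4 * (s : ℂ) ^ 2 * c ^ 2 + 2 * (s ^ 2 - c ^ 2) ^ 2) * this
  rw [e, Complex.add_re, Complex.ofReal_re, Complex.re_ofReal_mul, Complex.add_re, Complex.conj_re]
  have h1 : |(G * conj t).re| ≤ ‖G‖ * ‖t‖ := by
    refine (Complex.abs_re_le_norm _).trans ?_
    rw [norm_mul, RCLike.norm_conj]
  have h2 : |(s ^ 2 - c ^ 2) * (G * conj t).re| ≤ ‖G‖ * ‖t‖ := by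
    rw [abs_mul]
    refine (mul_le_of_le_one_left (abs_nonneg _) ?_).trans h1
    rw [abs_le]
    constructor <;> nlinarith [sq_nonneg s, sq_nonneg c]
  have h3 := (abs_le.1 h2).1
  have h4 : 4 * s ^ 2 * c ^ 2 + 2 * (s ^ 2 - c ^ 2) ^ 2 = 1 + (s ^ 2 - c ^ 2) ^ 2 := by
    linear_combination (s ^ 2 + c ^ 2 + 1) * h
  rw [h4]
  have h5 := norm_nonneg t
  have h6 := mul_le_mul_of_nonneg_right hG h5
  nlinarith [sq_nonneg (‖t‖ - 16 * δ * (2 * c * s)), sq_nonneg (‖t‖ - 8 * P),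
    mul_nonneg (sq_nonneg (s ^ 2 - c ^ 2)) (sq_nonneg ‖t‖)]

/-- Boundedness of `t` makes `tanh |t|²` bounded, so integrating its derivative over `[-n, n]`
controls `∫ |t|²` uniformly in `n`. -/
theorem riccati_sq_integrable (hp : MemLp p 2) (hδ0 : 0 ≤ δ)
    (hδ1 : δ ≤ 1 / 200) (hδ : ∫ x, ‖p x‖ ^ 2 ≤ δ ^ 2) (ht : ∀ x, ‖t x‖ ≤ 2 * δ)
    (hμ : ‖μ‖ ≤ 2 * δ)
    (hd : HasACDeriv t fun x => (Real.tanh x : ℂ) * t x - μ * sech x + riccatiSource p t μ x) :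
    Integrable (fun x => ‖t x‖ ^ 2) ∧ ∫ x, ‖t x‖ ^ 2 ≤ 304 * δ ^ 2 := by
  have hC := hasACDeriv_frameCos
  have hS := hasACDeriv_frameSin
  set G : ℝ → ℂ := fun x => riccatiSource p t μ x - μ * sech x with hGdef
  have hGb : ∀ x, ‖G x‖ ≤ 2 * δ * (2 * frameCos x * frameSin x) + ‖t x‖ / 16 + 2 * ‖p x‖ := by
    intro x
    refine (norm_sub_le _ _).trans ?_
    have h1 := norm_riccatiSource_le (p := p) hδ1 ht hμ x
    rw [norm_mul, Complex.norm_real, Real.norm_of_nonneg (sech_pos x).le,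
      two_mul_frameCos_mul_frameSin]
    have h2 := mul_le_mul_of_nonneg_right hμ (sech_pos x).le
    linarith
  have hd' : HasACDeriv t fun x => ((frameSin x : ℂ) ^ 2 - (frameCos x : ℂ) ^ 2) * t x + G x :=
    hd.of_eq_deriv fun x => by rw [hGdef, ofReal_tanh_eq_frame]; ring
  set F : ℝ → ℂ := fun x => ((frameSin x : ℂ) ^ 2 - (frameCos x : ℂ) ^ 2) * (t x * conj (t x))
    with hF
  set F' : ℝ → ℂ := fun x => 4 * (frameSin x : ℂ) ^ 2 * (frameCos x : ℂ) ^ 2 * (t x * conj (t x)) +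
    ((frameSin x : ℂ) ^ 2 - (frameCos x : ℂ) ^ 2) *
      ((((frameSin x : ℂ) ^ 2 - (frameCos x : ℂ) ^ 2) * t x + G x) * conj (t x) +
        t x * conj (((frameSin x : ℂ) ^ 2 - (frameCos x : ℂ) ^ 2) * t x + G x)) with hF'
  have hFd : HasACDeriv F F' := by
    have := ((hS.mul hS).sub (hC.mul hC)).mul (hd'.mul hd'.star)
    simp only [← sq] at this
    exact this.of_eq_deriv fun x => by simp only [hF']; ring
  have hre := hFd.clm Complex.reCLM
  simp only [Complex.reCLM_apply] at hre
  set M : ℝ → ℝ := fun x => 64 * δ ^ 2 * sech x ^ 2 + 32 * ‖p x‖ ^ 2 with hM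
  have hp2 : Integrable fun x => ‖p x‖ ^ 2 := hp.norm.integrable_sq
  have hMi : Integrable M := (integrable_sech_sq.const_mul _).add (hp2.const_mul _)
  have hMle : ∫ x, M x ≤ 288 * δ ^ 2 := by
    rw [hM, integral_add (integrable_sech_sq.const_mul _) (hp2.const_mul _), integral_const_mul,
      integral_const_mul]
    nlinarith [mul_le_mul_of_nonneg_left integral_sech_sq_le (sq_nonneg δ)]
  have hpt : ∀ x, ‖t x‖ ^ 2 ≤ 2 * (F' x).re + M x := fun x => by
    have := sq_norm_le_energy (frameSin_sq_add_frameCos_sq x) (hGb x)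
    rwa [two_mul_frameCos_mul_frameSin] at this
  have hFb : ∀ x, |(F x).re| ≤ 4 * δ ^ 2 := fun x => by
    refine (Complex.abs_re_le_norm _).trans ?_
    rw [hF, norm_mul, norm_mul, RCLike.norm_conj]
    calc _ ≤ 1 * (2 * δ * (2 * δ)) := by
          gcongr
          · exact norm_sq_sub_sq_le (frameSin_sq_add_frameCos_sq x)
          · exact ht x
          · exact ht x
      _ = _ := by ring
  have htc : Continuous fun x => ‖t x‖ ^ 2 := hd.continuous.norm.pow 2
  -- The constant is `304 = 288 + 2 · (4 + 4)`: the source terms plus twice the two boundary values.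
  have hbound : ∀ n : ℕ, ∫ x in -(n : ℝ)..n, ‖t x‖ ^ 2 ≤ 304 * δ ^ 2 := fun n => by
    have hle : -(n : ℝ) ≤ n := by linarith [n.cast_nonneg (α := ℝ)]
    have hi := (hre.intervalIntegrable (-n) n).const_mul 2
    have hi2 : IntervalIntegrable M volume (-n) n := hMi.intervalIntegrable
    have h1 := intervalIntegral.integral_mono_on hle (htc.intervalIntegrable _ _)
      (hi.add hi2) fun x _ => hpt x
    rw [intervalIntegral.integral_add hi hi2, intervalIntegral.integral_const_mul,
      hre.integral_eq_sub] at h1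
    have h2 : ∫ x in -(n : ℝ)..n, M x ≤ ∫ x, M x := by
      rw [intervalIntegral.integral_of_le hle]
      refine setIntegral_le_integral hMi (Eventually.of_forall fun x => ?_)
      simp only [hM, Pi.zero_apply]; positivity
    have h3 := (abs_le.1 (hFb n)).2
    have h4 := (abs_le.1 (hFb (-n))).1
    linarith
  have hb : Tendsto (fun n : ℕ => (n : ℝ)) atTop atTop := tendsto_natCast_atTop_atTop
  have ha : Tendsto (fun n : ℕ => -(n : ℝ)) atTop atBot := tendsto_neg_atTop_atBot.comp hb
  have hint : Integrable fun x => ‖t x‖ ^ 2 := by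
    refine integrable_of_intervalIntegral_norm_bounded (304 * δ ^ 2)
      (fun n => (htc.integrableOn_Icc).mono_set Ioc_subset_Icc_self) ha hb
      (Eventually.of_forall fun n => ?_)
    simpa using hbound n
  exact ⟨hint, le_of_tendsto' (intervalIntegral_tendsto_integral hint ha hb) hbound⟩

end Energy

/-! ### The amplitude and the perturbed eigenvector. -/

section Eigenvector

variable {p t : ℝ → ℂ} {μ : ℂ} {δ : ℝ}

/-- The logarithmic derivative of the amplitude, up to the term `-η tanh`. -/
def amplitudeRate (p t : ℝ → ℂ) (μ : ℂ) (x : ℝ) : ℂ :=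
  (conj (p x) - p x) * (frameCos x * frameSin x) -
    t x * ((2 + 2 * μ) * (frameCos x * frameSin x) +
      (p x * (frameCos x : ℂ) ^ 2 + conj (p x) * (frameSin x : ℂ) ^ 2))

/-- All terms carry a factor `sech` except the one of size `|t| |p|`. That one is integrable only
because `t` is in `L²`; boundedness of `t` would not suffice. -/
theorem norm_amplitudeRate_le (hδ1 : δ ≤ 1 / 200) (ht : ∀ x, ‖t x‖ ≤ 2 * δ)
    (hμ : ‖μ‖ ≤ 2 * δ) (x : ℝ) :
    ‖amplitudeRate p t μ x‖ ≤
      2 * (Real.exp (-|0 - x|) * (4 * δ + 1 * ‖p x‖)) + (‖t x‖ ^ 2 + ‖p x‖ ^ 2) := by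
  have hcs : ((frameCos x : ℂ) * frameSin x) = ((sech x / 2 : ℝ) : ℂ) := by
    push_cast; rw [ofReal_sech_eq_frame]; ring
  have hs0 := sech_pos x
  have hn : ‖((sech x / 2 : ℝ) : ℂ)‖ = sech x / 2 := by
    rw [Complex.norm_real, Real.norm_of_nonneg (by positivity)]
  have h1 : ‖p x * (frameCos x : ℂ) ^ 2 + conj (p x) * (frameSin x : ℂ) ^ 2‖ ≤ ‖p x‖ :=
    norm_mul_sq_add_conj_mul_sq_le ((add_comm _ _).trans (frameSin_sq_add_frameCos_sq x)) (p x)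
  have h2 : ‖conj (p x) - p x‖ ≤ 2 * ‖p x‖ := by rw [norm_sub_rev]; exact norm_sub_conj_le _
  have h3 : ‖2 + 2 * μ‖ ≤ 4 := by
    refine (norm_add_le _ _).trans ?_
    rw [norm_mul, Complex.norm_ofNat]
    linarith
  have h0 : 0 ≤ δ := by linarith [(norm_nonneg _).trans hμ]
  rw [amplitudeRate, hcs]
  calc _ ≤ ‖conj (p x) - p x‖ * (sech x / 2) + ‖t x‖ * (‖2 + 2 * μ‖ * (sech x / 2) +
        ‖p x * (frameCos x : ℂ) ^ 2 + conj (p x) * (frameSin x : ℂ) ^ 2‖) := by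
        refine (norm_sub_le _ _).trans ?_
        rw [norm_mul, norm_mul, hn]
        gcongr
        refine (norm_add_le _ _).trans ?_
        rw [norm_mul, hn]
    _ ≤ 2 * ‖p x‖ * (sech x / 2) + ‖t x‖ * (4 * (sech x / 2) + ‖p x‖) := by gcongr
    _ = ‖p x‖ * sech x + ‖t x‖ * (2 * sech x) + ‖t x‖ * ‖p x‖ := by ring
    _ ≤ ‖p x‖ * sech x + (2 * δ) * (2 * sech x) + (‖t x‖ ^ 2 + ‖p x‖ ^ 2) := by
        gcongr
        · exact ht x
        · nlinarith [sq_nonneg (‖t x‖ - ‖p x‖), sq_nonneg ‖t x‖, sq_nonneg ‖p x‖]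
    _ = sech x * (4 * δ + ‖p x‖) + (‖t x‖ ^ 2 + ‖p x‖ ^ 2) := by ring
    _ ≤ 2 * Real.exp (-|x|) * (4 * δ + ‖p x‖) + (‖t x‖ ^ 2 + ‖p x‖ ^ 2) := by
        gcongr
        exact sech_le x
    _ = _ := by rw [zero_sub, abs_neg]; ring

theorem amplitudeRate_integrable (hp : MemLp p 2) (hδ0 : 0 ≤ δ)
    (hδ1 : δ ≤ 1 / 200) (hδ : ∫ x, ‖p x‖ ^ 2 ≤ δ ^ 2) (ht : ∀ x, ‖t x‖ ≤ 2 * δ)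
    (hμ : ‖μ‖ ≤ 2 * δ) (htc : Continuous t) (hti : Integrable fun x => ‖t x‖ ^ 2)
    (htl : ∫ x, ‖t x‖ ^ 2 ≤ 304 * δ ^ 2) :
    Integrable (amplitudeRate p t μ) ∧ ∫ x, ‖amplitudeRate p t μ x‖ ≤ 20 * δ := by
  have hp2 : Integrable fun x => ‖p x‖ ^ 2 := hp.norm.integrable_sq
  have hk := (integrable_kernel hp (4 * δ) 1 0).const_mul 2
  have hkl := integral_kernel_le hp hδ0 hδ zero_le_one (4 * δ) 0
  have hc := (Complex.continuous_ofReal.comp continuous_frameCos).aestronglyMeasurable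
    (μ := (volume : Measure ℝ))
  have hs := (Complex.continuous_ofReal.comp continuous_frameSin).aestronglyMeasurable
    (μ := (volume : Measure ℝ))
  have hp' := Complex.continuous_conj.comp_aestronglyMeasurable hp.1
  have hm : AEStronglyMeasurable (amplitudeRate p t μ) :=
    ((hp'.sub hp.1).mul (hc.mul hs)).sub (htc.aestronglyMeasurable.mul
      (((hc.mul hs).const_mul (2 + 2 * μ)).add ((hp.1.mul (hc.pow 2)).add (hp'.mul (hs.pow 2)))))
  have hdom := hk.add (hti.add hp2)
  have hi : Integrable (amplitudeRate p t μ) :=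
    hdom.mono' hm (Eventually.of_forall (norm_amplitudeRate_le hδ1 ht hμ))
  refine ⟨hi, ?_⟩
  have h1 := integral_mono hi.norm hdom (norm_amplitudeRate_le hδ1 ht hμ)
  refine h1.trans ?_
  have e : ∫ x, ((fun x => 2 * (Real.exp (-|0 - x|) * (4 * δ + 1 * ‖p x‖))) +
      ((fun x => ‖t x‖ ^ 2) + fun x => ‖p x‖ ^ 2)) x =
      2 * (∫ x, Real.exp (-|0 - x|) * (4 * δ + 1 * ‖p x‖)) +
        ((∫ x, ‖t x‖ ^ 2) + ∫ x, ‖p x‖ ^ 2) := by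
    rw [integral_add' hk (hti.add hp2), integral_add' hti hp2, integral_const_mul]
  rw [e]
  -- The kernel part gives `18 δ`, and the squares give `305 δ² ≤ 2 δ`.
  nlinarith

/-- The amplitude of the perturbed eigenvector. -/
def amplitude (p t : ℝ → ℂ) (μ : ℂ) (x : ℝ) : ℂ :=
  √2 * Complex.exp (-((1 / 2 + μ) * (Real.log (Real.cosh x) : ℝ)) +
    ∫ y in (0 : ℝ)..x, amplitudeRate p t μ y)

theorem amplitude_ne_zero (x : ℝ) : amplitude p t μ x ≠ 0 :=
  mul_ne_zero (by simp) (Complex.exp_ne_zero _)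

theorem hasACDeriv_amplitude (hi : Integrable (amplitudeRate p t μ)) :
    HasACDeriv (amplitude p t μ) fun x =>
      amplitude p t μ x * (-(1 / 2 + μ) * Real.tanh x + amplitudeRate p t μ x) := by
  have hL : HasACDeriv (fun x => ((Real.log (Real.cosh x) : ℝ) : ℂ))
      (fun x => (Real.tanh x : ℂ)) := by
    refine (HasACDeriv.of_hasDerivAt (fun x => ?_) ?_).ofReal
    · rw [Real.tanh_eq_sinh_div_cosh]
      exact (Real.hasDerivAt_cosh x).log (Real.cosh_pos x).ne'
    · rw [funext Real.tanh_eq_sinh_div_cosh]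
      exact Real.continuous_sinh.div Real.continuous_cosh fun x => (Real.cosh_pos x).ne'
  have h := (((hL.const_mul (1 / 2 + μ)).neg.add
    (HasACDeriv.integral_of_locallyIntegrable hi.locallyIntegrable 0)).cexp).const_mul (√2 : ℂ)
  exact h.of_eq_deriv fun x => by rw [amplitude]; ring

theorem norm_integral_amplitudeRate_le (hi : Integrable (amplitudeRate p t μ))
    (hl : ∫ x, ‖amplitudeRate p t μ x‖ ≤ 20 * δ) (x : ℝ) :
    ‖∫ y in (0 : ℝ)..x, amplitudeRate p t μ y‖ ≤ 20 * δ :=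
  intervalIntegral.norm_integral_le_integral_norm_uIoc.trans
    ((setIntegral_le_integral hi.norm (Eventually.of_forall fun _ => norm_nonneg _)).trans hl)

theorem log_cosh_nonneg (x : ℝ) : 0 ≤ Real.log (Real.cosh x) := Real.log_nonneg (Real.one_le_cosh x)

theorem abs_sub_one_le_log_cosh (x : ℝ) : |x| - 1 ≤ Real.log (Real.cosh x) := by
  rw [Real.le_log_iff_exp_le (Real.cosh_pos x), Real.exp_sub, ← Real.cosh_abs, Real.cosh_eq,
    div_le_div_iff₀ (Real.exp_pos 1) two_pos]
  have h2 : 2 ≤ Real.exp 1 := by linarith [Real.add_one_le_exp 1]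
  have h3 : 0 < Real.exp (-|x|) := Real.exp_pos _
  nlinarith [Real.exp_pos |x|]

/-- The real part of `1/2 + μ` stays above `1/4` and `log cosh x ≥ |x| - 1`, which leaves the decay
rate `1/4`. -/
theorem norm_amplitude_le (hδ1 : δ ≤ 1 / 200) (hμ : ‖μ‖ ≤ 2 * δ)
    (hi : Integrable (amplitudeRate p t μ)) (hl : ∫ x, ‖amplitudeRate p t μ x‖ ≤ 20 * δ) (x : ℝ) :
    ‖amplitude p t μ x‖ ≤ 6 * Real.exp (-|x| / 4) := by
  have hH := (Complex.re_le_norm _).trans (norm_integral_amplitudeRate_le hi hl x)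
  have hre := (abs_le.1 ((Complex.abs_re_le_norm μ).trans hμ)).1
  have hL := log_cosh_nonneg x
  have hL1 := abs_sub_one_le_log_cosh x
  rw [amplitude, norm_mul, Complex.norm_exp, Complex.norm_real, Real.norm_of_nonneg (by positivity),
    Complex.add_re, Complex.neg_re, Complex.re_mul_ofReal, Complex.add_re]
  have h12 : ((1 / 2 : ℂ)).re = 1 / 2 := by norm_num
  rw [h12]
  have hexp : -((1 / 2 + μ.re) * Real.log (Real.cosh x)) +
      (∫ y in (0 : ℝ)..x, amplitudeRate p t μ y).re ≤ 1 + -|x| / 4 := by nlinarith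
  have h3 : Real.exp 1 ≤ 3 := Real.exp_one_lt_three.le
  have hs2 : √2 ≤ 2 := by
    rw [Real.sqrt_le_left (by norm_num)]; norm_num
  calc _ ≤ 2 * Real.exp (1 + -|x| / 4) := by gcongr
    _ = 2 * Real.exp 1 * Real.exp (-|x| / 4) := by rw [Real.exp_add]; ring
    _ ≤ 2 * 3 * Real.exp (-|x| / 4) := by gcongr
    _ = _ := by norm_num

/-- The ratio to the soliton amplitude is `exp z`, where `z` may grow like `δ log cosh x`. The decay
of the soliton amplitude compensates, making the error uniformly `O(δ)`. -/
theorem norm_amplitude_sub_le (hδ0 : 0 ≤ δ) (hδ1 : δ ≤ 1 / 200) (hμ : ‖μ‖ ≤ 2 * δ)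
    (hi : Integrable (amplitudeRate p t μ)) (hl : ∫ x, ‖amplitudeRate p t μ x‖ ≤ 20 * δ) (x : ℝ) :
    ‖amplitude p t μ x - (√2 * Real.exp (-(Real.log (Real.cosh x) / 2)) : ℝ)‖ ≤ 168 * δ := by
  have hH := norm_integral_amplitudeRate_le hi hl x
  have hL := log_cosh_nonneg x
  rw [amplitude]
  set L := Real.log (Real.cosh x)
  set H := ∫ y in (0 : ℝ)..x, amplitudeRate p t μ y
  set z : ℂ := -(μ * L) + H with hz
  have hzb : ‖z‖ ≤ 2 * δ * L + 20 * δ := by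
    refine (norm_add_le _ _).trans (add_le_add ?_ hH)
    rw [norm_neg, norm_mul, Complex.norm_real, Real.norm_of_nonneg hL]
    gcongr
  have e : (√2 : ℂ) * Complex.exp (-((1 / 2 + μ) * L) + H) -
      (√2 * Real.exp (-(L / 2)) : ℝ) =
      (√2 : ℂ) * ((Real.exp (-(L / 2)) : ℝ) : ℂ) * (Complex.exp z - 1) := by
    have h1 : -((1 / 2 + μ) * (L : ℂ)) + H = ((-(L / 2) : ℝ) : ℂ) + z := by
      rw [hz]; push_cast; ring
    rw [h1, Complex.exp_add, ← Complex.ofReal_exp]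
    push_cast; ring
  rw [e, norm_mul, norm_mul, Complex.norm_real, Complex.norm_real,
    Real.norm_of_nonneg (by positivity), Real.norm_of_nonneg (by positivity)]
  -- One term of the series gives `‖exp z - 1‖ ≤ ‖z‖ exp ‖z‖`; below, `‖z‖ ≤ L / 4 + 1`, so half of
  -- the decay `exp (-L / 2)` survives.
  have hexp := Complex.norm_exp_sub_sum_le_norm_mul_exp z 1
  simp only [Finset.range_one, Finset.sum_singleton, pow_zero, Nat.factorial_zero, Nat.cast_one,
    div_one, pow_one] at hexp
  have h3 : Real.exp 1 ≤ 3 := Real.exp_one_lt_three.le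
  have hs2 : √2 ≤ 2 := by
    rw [Real.sqrt_le_left (by norm_num)]; norm_num
  have hLe : L * Real.exp (-(L / 4)) ≤ 4 := by
    have h4 : L / 4 ≤ Real.exp (L / 4) := by linarith [Real.add_one_le_exp (L / 4)]
    calc L * Real.exp (-(L / 4)) = 4 * (L / 4) * Real.exp (-(L / 4)) := by ring
      _ ≤ 4 * Real.exp (L / 4) * Real.exp (-(L / 4)) := by gcongr
      _ = 4 := by rw [mul_assoc, ← Real.exp_add]; simp
  have hle1 : Real.exp (-(L / 4)) ≤ 1 := Real.exp_le_one_iff.2 (by linarith)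
  calc √2 * Real.exp (-(L / 2)) * ‖Complex.exp z - 1‖
      ≤ 2 * Real.exp (-(L / 2)) * ((2 * δ * L + 20 * δ) * Real.exp (L / 4 + 1)) := by
        gcongr
        refine hexp.trans ?_
        gcongr
        refine hzb.trans ?_
        nlinarith
    _ = 2 * (2 * δ * (L * Real.exp (-(L / 4))) + 20 * δ * Real.exp (-(L / 4))) * Real.exp 1 := by
        have : Real.exp (-(L / 2)) * Real.exp (L / 4 + 1) = Real.exp (-(L / 4)) * Real.exp 1 := by
          rw [← Real.exp_add, ← Real.exp_add]; congr 1; ring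
        linear_combination 2 * (2 * δ * L + 20 * δ) * this
    _ ≤ 2 * (2 * δ * 4 + 20 * δ * 1) * 3 := by gcongr
    _ = 168 * δ := by ring

/-- `amplitudeRate` and the Riccati equation are the components of the spectral problem along `(-c,
s)` and `(s, c)`. The check is a polynomial identity modulo `s² + c² = 1`, with `p̄` treated as
independent of `p`. -/
theorem hasACDeriv_eigenvector_fst
    (hi : Integrable (amplitudeRate p t μ))
    (hd : HasACDeriv t fun x => (Real.tanh x : ℂ) * t x - μ * sech x + riccatiSource p t μ x) :
    HasACDeriv (fun x => amplitude p t μ x * (-frameCos x + t x * frameSin x)) fun x =>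
      (1 / 2 + μ) * (amplitude p t μ x * (-frameCos x + t x * frameSin x)) +
        (sech x + p x) * (amplitude p t μ x * (frameSin x + t x * frameCos x)) := by
  refine ((hasACDeriv_amplitude hi).mul
    (hasACDeriv_frameCos.neg.add (hd.mul hasACDeriv_frameSin))).of_eq_deriv fun x => ?_
  have h1 : (frameSin x : ℂ) ^ 2 + (frameCos x : ℂ) ^ 2 = 1 := by
    exact_mod_cast frameSin_sq_add_frameCos_sq x
  rw [riccatiSource, riccatiForm, amplitudeRate, ofReal_tanh_eq_frame, ofReal_sech_eq_frame]
  generalize conj (p x) = q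
  generalize amplitude p t μ x = a
  grind

theorem hasACDeriv_eigenvector_snd
    (hi : Integrable (amplitudeRate p t μ))
    (hd : HasACDeriv t fun x => (Real.tanh x : ℂ) * t x - μ * sech x + riccatiSource p t μ x) :
    HasACDeriv (fun x => amplitude p t μ x * (frameSin x + t x * frameCos x)) fun x =>
      -(sech x + conj (p x)) * (amplitude p t μ x * (-frameCos x + t x * frameSin x)) -
        (1 / 2 + μ) * (amplitude p t μ x * (frameSin x + t x * frameCos x)) := by
  refine ((hasACDeriv_amplitude hi).mul
    (hasACDeriv_frameSin.add (hd.mul hasACDeriv_frameCos))).of_eq_deriv fun x => ?_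
  have h1 : (frameSin x : ℂ) ^ 2 + (frameCos x : ℂ) ^ 2 = 1 := by
    exact_mod_cast frameSin_sq_add_frameCos_sq x
  rw [riccatiSource, riccatiForm, amplitudeRate, ofReal_tanh_eq_frame, ofReal_sech_eq_frame]
  generalize conj (p x) = q
  generalize amplitude p t μ x = a
  grind

end Eigenvector

/-! ### Uniqueness of eigenvectors and regularity of the Bäcklund transform. -/

section LaxSystem

variable {η : ℂ} {Q ψ₁ ψ₂ φ₁ φ₂ : ℝ → ℂ}

/-- `(ψ₁, ψ₂)` is a locally absolutely continuous solution of the spectral problem. -/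
structure IsLaxSolution (η : ℂ) (Q ψ₁ ψ₂ : ℝ → ℂ) : Prop where
  fst : HasACDeriv ψ₁ fun x => η * ψ₁ x + Q x * ψ₂ x
  snd : HasACDeriv ψ₂ fun x => -conj (Q x) * ψ₁ x - η * ψ₂ x

theorem laxMatrix_mulVec_zero (η q : ℂ) (v : Fin 2 → ℂ) :
    (laxMatrix η q *ᵥ v) 0 = η * v 0 + q * v 1 := by
  simp [laxMatrix, Matrix.mulVec, dotProduct, Fin.sum_univ_two]

theorem laxMatrix_mulVec_one (η q : ℂ) (v : Fin 2 → ℂ) :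
    (laxMatrix η q *ᵥ v) 1 = -conj q * v 0 - η * v 1 := by
  simp [laxMatrix, Matrix.mulVec, dotProduct, Fin.sum_univ_two]
  ring

theorem IsLaxSolution.hasACDeriv (h : IsLaxSolution η Q ψ₁ ψ₂) :
    HasACDeriv (fun x => ![ψ₁ x, ψ₂ x]) fun x => laxMatrix η (Q x) *ᵥ ![ψ₁ x, ψ₂ x] := by
  have h1 := (h.fst.clm (ContinuousLinearMap.single ℝ (fun _ : Fin 2 => ℂ) 0)).add
    (h.snd.clm (ContinuousLinearMap.single ℝ (fun _ : Fin 2 => ℂ) 1))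
  have e : ∀ a b : ℂ, (ContinuousLinearMap.single ℝ (fun _ : Fin 2 => ℂ) 0) a +
      (ContinuousLinearMap.single ℝ (fun _ : Fin 2 => ℂ) 1) b = ![a, b] := fun a b => by
    ext i; fin_cases i <;> simp
  simp only [e] at h1
  refine h1.of_eq_deriv fun x => ?_
  ext i
  fin_cases i
  · exact (laxMatrix_mulVec_zero η (Q x) ![ψ₁ x, ψ₂ x]).symm
  · exact (laxMatrix_mulVec_one η (Q x) ![ψ₁ x, ψ₂ x]).symm

theorem IsLaxEigenvector.exists_isLaxSolution {Φ : ℝ → Fin 2 → ℂ} (h : IsLaxEigenvector η Q Φ) :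
    ∃ F : ℝ → Fin 2 → ℂ, Φ =ᵐ[volume] F ∧
      IsLaxSolution η Q (fun x => F x 0) (fun x => F x 1) ∧
      MemLp (fun x => F x 0) 2 ∧ MemLp (fun x => F x 1) 2 := by
  obtain ⟨F, hF, hFd⟩ := h.eqn.exists_hasACDeriv
  have hF2 : MemLp F 2 := h.memH.1.ae_eq hF
  have hFd' : HasACDeriv F fun x => laxMatrix η (Q x) *ᵥ F x := hFd.congr_deriv (by
    filter_upwards [hF] with x hx
    rw [hx])
  refine ⟨F, hF, ⟨?_, ?_⟩, ?_, ?_⟩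
  · exact (hFd'.clm (ContinuousLinearMap.proj (R := ℝ) (0 : Fin 2))).of_eq_deriv fun x =>
      laxMatrix_mulVec_zero η (Q x) (F x)
  · exact (hFd'.clm (ContinuousLinearMap.proj (R := ℝ) (1 : Fin 2))).of_eq_deriv fun x =>
      laxMatrix_mulVec_one η (Q x) (F x)
  all_goals
    refine hF2.of_le ?_ (Eventually.of_forall fun x => norm_le_pi_norm _ _)
    exact ((continuous_apply _).comp hFd'.continuous).aestronglyMeasurable

/-- Square integrable solutions have vanishing Wronskian. -/
theorem IsLaxSolution.wronskian_eq_zero (h : IsLaxSolution η Q ψ₁ ψ₂)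
    (h' : IsLaxSolution η Q φ₁ φ₂) (hψ₁ : MemLp ψ₁ 2) (hψ₂ : MemLp ψ₂ 2) (hφ₁ : MemLp φ₁ 2)
    (hφ₂ : MemLp φ₂ 2) (x : ℝ) : φ₁ x * ψ₂ x = φ₂ x * ψ₁ x := by
  have hW : HasACDeriv (fun x => φ₁ x * ψ₂ x - φ₂ x * ψ₁ x) fun _ => 0 :=
    ((h'.fst.mul h.snd).sub (h'.snd.mul h.fst)).of_eq_deriv fun x => by ring
  have hi : Integrable fun x => φ₁ x * ψ₂ x - φ₂ x * ψ₁ x :=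
    (hφ₁.integrable_mul hψ₂).sub (hφ₂.integrable_mul hψ₁)
  have hc : (fun x => φ₁ x * ψ₂ x - φ₂ x * ψ₁ x) =
      fun _ => φ₁ 0 * ψ₂ 0 - φ₂ 0 * ψ₁ 0 := funext fun x => hW.eq_const x 0
  rw [hc, integrable_const_iff] at hi
  rcases hi with h0 | h0
  · have := hW.eq_const x 0
    simp only [h0] at this
    exact sub_eq_zero.1 this
  · exact absurd h0.measure_univ_lt_top (by simp)

theorem mul_inv_add_mul_neg_inv_sq_eq_zero {K : Type*} [Field K] {a a' b b' : K} (hb : b ≠ 0)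
    (h : a' * b = a * b') : a' * b⁻¹ + a * (-(b ^ 2)⁻¹ * b') = 0 := by
  field_simp
  linear_combination h

/-- The candidate `l = ⟨φ, ψ⟩ / |ψ|²` is constant: its derivative is a multiple of the Wronskian.
This replaces a uniqueness theorem for the system with an `L²` potential. -/
theorem IsLaxSolution.exists_eq_mul (h : IsLaxSolution η Q ψ₁ ψ₂)
    (h' : IsLaxSolution η Q φ₁ φ₂)
    (hN : ∀ x, ψ₁ x * conj (ψ₁ x) + ψ₂ x * conj (ψ₂ x) ≠ 0)
    (hW : ∀ x, φ₁ x * ψ₂ x = φ₂ x * ψ₁ x) :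
    ∃ l : ℂ, ∀ x, φ₁ x = l * ψ₁ x ∧ φ₂ x = l * ψ₂ x := by
  have hNd := (h.fst.mul h.fst.star).add (h.snd.mul h.snd.star)
  have hl := ((h'.fst.mul h.fst.star).add (h'.snd.mul h.snd.star)).mul (hNd.inv hN)
  have hl0 := hl.of_eq_deriv (h := fun _ => 0) fun x => by
    have h1 := hN x
    have h2 := hW x
    simp only [map_add, map_sub, map_mul, map_neg, Complex.conj_conj]
    generalize conj (ψ₁ x) = A at *
    generalize conj (ψ₂ x) = B at *
    refine mul_inv_add_mul_neg_inv_sq_eq_zero h1 ?_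
    linear_combination (2 * (η + conj η) * A * B) * h2
  refine ⟨(φ₁ 0 * conj (ψ₁ 0) + φ₂ 0 * conj (ψ₂ 0)) *
    (ψ₁ 0 * conj (ψ₁ 0) + ψ₂ 0 * conj (ψ₂ 0))⁻¹, fun x => ?_⟩
  rw [hl0.eq_const 0 x]
  have h1 := hN x
  have h2 := hW x
  constructor
  · rw [mul_right_comm, ← div_eq_mul_inv, eq_div_iff h1]
    linear_combination (conj (ψ₂ x)) * h2
  · rw [mul_right_comm, ← div_eq_mul_inv, eq_div_iff h1]
    linear_combination (-conj (ψ₁ x)) * h2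

/-- The quotient `ψ₁ ψ̄₂ / |ψ|²`. -/
def crossRatio (ψ₁ ψ₂ : ℝ → ℂ) (x : ℝ) : ℂ :=
  (ψ₁ x * conj (ψ₂ x)) * (ψ₁ x * conj (ψ₁ x) + ψ₂ x * conj (ψ₂ x))⁻¹

/-- The quotient `(|ψ₁|² - |ψ₂|²) / |ψ|²`. -/
def diffRatio (ψ₁ ψ₂ : ℝ → ℂ) (x : ℝ) : ℂ :=
  (ψ₁ x * conj (ψ₁ x) - ψ₂ x * conj (ψ₂ x)) * (ψ₁ x * conj (ψ₁ x) + ψ₂ x * conj (ψ₂ x))⁻¹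

theorem mul_conj_add_mul_conj (a b : ℂ) :
    a * conj a + b * conj b = ((‖a‖ ^ 2 + ‖b‖ ^ 2 : ℝ) : ℂ) := by
  rw [Complex.mul_conj', Complex.mul_conj']; push_cast; rfl

theorem norm_diffRatio_le (x : ℝ) : ‖diffRatio ψ₁ ψ₂ x‖ ≤ 1 := by
  rw [diffRatio, mul_conj_add_mul_conj, ← div_eq_mul_inv, norm_div,
    Complex.norm_real, Real.norm_of_nonneg (by positivity)]
  refine div_le_one_of_le₀ ((norm_sub_le _ _).trans ?_) (by positivity)
  rw [norm_mul, norm_mul, RCLike.norm_conj, RCLike.norm_conj, sq, sq]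

/-- Together with the next lemma this is a closed system for `P = crossRatio` and `D = diffRatio`:
with `R = Q + 2 Re η · P`, `P' = (η - η̄) P - D R` and `D' = 2 (P̄ R + P R̄)`. No derivative of `Q`
appears. -/
theorem IsLaxSolution.hasACDeriv_crossRatio (h : IsLaxSolution η Q ψ₁ ψ₂)
    (hN : ∀ x, ψ₁ x * conj (ψ₁ x) + ψ₂ x * conj (ψ₂ x) ≠ 0) :
    HasACDeriv (crossRatio ψ₁ ψ₂) fun x => (η - conj η) * crossRatio ψ₁ ψ₂ x +
      -1 * (diffRatio ψ₁ ψ₂ x * (Q x + (η + conj η) * crossRatio ψ₁ ψ₂ x)) := by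
  have hNd := (h.fst.mul h.fst.star).add (h.snd.mul h.snd.star)
  refine ((h.fst.mul h.snd.star).mul (hNd.inv hN)).of_eq_deriv fun x => ?_
  have h1 := hN x
  simp only [crossRatio, diffRatio, map_add, map_sub, map_mul, map_neg, Complex.conj_conj]
  generalize conj (ψ₁ x) = A at *
  generalize conj (ψ₂ x) = B at *
  field_simp
  ring

theorem IsLaxSolution.hasACDeriv_diffRatio (h : IsLaxSolution η Q ψ₁ ψ₂)
    (hN : ∀ x, ψ₁ x * conj (ψ₁ x) + ψ₂ x * conj (ψ₂ x) ≠ 0) :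
    HasACDeriv (diffRatio ψ₁ ψ₂) fun x =>
      2 * (conj (crossRatio ψ₁ ψ₂ x) * (Q x + (η + conj η) * crossRatio ψ₁ ψ₂ x) +
        crossRatio ψ₁ ψ₂ x * conj (Q x + (η + conj η) * crossRatio ψ₁ ψ₂ x)) := by
  have hNd := (h.fst.mul h.fst.star).add (h.snd.mul h.snd.star)
  refine (((h.fst.mul h.fst.star).sub (h.snd.mul h.snd.star)).mul
    (hNd.inv hN)).of_eq_deriv fun x => ?_
  have h1 := hN x
  have h2 : conj (ψ₁ x) * ψ₁ x + conj (ψ₂ x) * ψ₂ x ≠ 0 := by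
    rwa [mul_comm (conj _), mul_comm (conj _)]
  simp only [crossRatio, map_add, map_sub, map_mul, map_neg, map_inv₀, Complex.conj_conj]
  generalize conj (ψ₁ x) = A at *
  generalize conj (ψ₂ x) = B at *
  rw [show A * ψ₁ x + B * ψ₂ x = ψ₁ x * A + ψ₂ x * B by ring]
  field_simp
  ring

/-- Bootstrap on that system: `P'` is no rougher than `Q` and `P`, so each step gains a derivative.
`D` enters only through its boundedness and the regularity of `D'`. -/
theorem IsLaxSolution.memH_crossRatio (h : IsLaxSolution η Q ψ₁ ψ₂)
    (hN : ∀ x, ψ₁ x * conj (ψ₁ x) + ψ₂ x * conj (ψ₂ x) ≠ 0)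
    (hP : MemLp (crossRatio ψ₁ ψ₂) 2) {n : ℕ} (hQ : MemH n Q) :
    MemH (n + 1) (crossRatio ψ₁ ψ₂) := by
  have hPd := (h.hasACDeriv_crossRatio hN).hasWeakDeriv
  have hDd := (h.hasACDeriv_diffRatio hN).hasWeakDeriv
  have hDb : ∀ᵐ x, ‖diffRatio ψ₁ ψ₂ x‖ ≤ 1 := Eventually.of_forall norm_diffRatio_le
  induction n with
  | zero =>
    refine ⟨hP, _, hPd, ?_⟩
    have h0 : MemLp (fun x => Q x + (η + conj η) * crossRatio ψ₁ ψ₂ x) 2 :=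
      MemLp.add hQ (hP.const_mul _)
    exact (hP.const_mul _).add
      ((h0.bounded_mul hDd.locallyIntegrable.aestronglyMeasurable hDb).const_mul _)
  | succ n ih =>
    have hPn := ih hQ.of_succ
    have hR : MemH (n + 1) fun x => Q x + (η + conj η) * crossRatio ψ₁ ψ₂ x :=
      hQ.add (hPn.const_mul _)
    refine ⟨hP, _, hPd, (hPn.const_mul _).add (MemH.const_mul _ ?_)⟩
    exact MemH.mul_of_bounded hDd hDb (((hPn.star.mul hR).add (hPn.mul hR.star)).const_mul 2) hR

theorem backlundTransform_eq (k : ℝ) (Q ψ₁ ψ₂ : ℝ → ℂ) (x : ℝ) :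
    backlundTransform k Q (fun x => ![ψ₁ x, ψ₂ x]) x =
      -1 * Q x + -(2 * k) * crossRatio ψ₁ ψ₂ x := by
  simp only [backlundTransform, crossRatio, mul_conj_add_mul_conj, Matrix.cons_val_zero,
    Matrix.cons_val_one]
  ring

theorem backlundTransform_smul {l : ℂ} (hl : l ≠ 0) (k : ℝ) (Q : ℝ → ℂ) {Φ Ψ : ℝ → Fin 2 → ℂ}
    {x : ℝ} (h0 : Φ x 0 = l * Ψ x 0) (h1 : Φ x 1 = l * Ψ x 1) :
    backlundTransform k Q Φ x = backlundTransform k Q Ψ x := by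
  have hl' : conj l ≠ 0 := (map_ne_zero _).2 hl
  simp only [backlundTransform, h0, h1, ← mul_conj_add_mul_conj, map_mul]
  rw [show l * Ψ x 0 * (conj l * conj (Ψ x 0)) + l * Ψ x 1 * (conj l * conj (Ψ x 1)) =
    (l * conj l) * (Ψ x 0 * conj (Ψ x 0) + Ψ x 1 * conj (Ψ x 1)) by ring,
    show 2 * (k : ℂ) * (l * Ψ x 0) * (conj l * conj (Ψ x 1)) =
    (l * conj l) * (2 * k * Ψ x 0 * conj (Ψ x 1)) by ring,
    mul_div_mul_left _ _ (mul_ne_zero hl hl')]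

end LaxSystem

/-! ### `L²` norms and the soliton in frame form. -/

section Norms

theorem eLpNorm_two_eq {f : ℝ → ℂ} (hf : MemLp f 2) :
    eLpNorm f 2 volume = ENNReal.ofReal √(∫ x, ‖f x‖ ^ 2) := by
  rw [hf.eLpNorm_eq_integral_rpow_norm two_ne_zero ENNReal.ofNat_ne_top]
  simp [Real.sqrt_eq_rpow]

theorem eLpNorm_two_le {f : ℝ → ℂ} {B : ℝ} (hf : MemLp f 2) (hB : 0 ≤ B)
    (h : ∫ x, ‖f x‖ ^ 2 ≤ B ^ 2) : eLpNorm f 2 volume ≤ ENNReal.ofReal B := by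
  rw [eLpNorm_two_eq hf]
  exact ENNReal.ofReal_le_ofReal ((Real.sqrt_le_left hB).2 h)

theorem solitonProfile_eq (x : ℝ) : solitonProfile x = (sech x : ℂ) := rfl

theorem memLp_solitonProfile : MemLp solitonProfile 2 := by
  have hc : Continuous solitonProfile := Complex.continuous_ofReal.comp continuous_sech
  rw [memLp_two_iff_integrable_sq_norm hc.aestronglyMeasurable]
  refine integrable_sech_sq.congr (Eventually.of_forall fun x => ?_)
  simp only
  rw [solitonProfile_eq, Complex.norm_real, Real.norm_of_nonneg (sech_pos x).le]

theorem exp_neg_half_log_cosh_div (x : ℝ) :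
    √2 * Real.exp (-(Real.log (Real.cosh x) / 2)) / √(2 * Real.cosh x) = sech x := by
  have hc := Real.cosh_pos x
  rw [Real.exp_neg, Real.exp_half, Real.exp_log hc, Real.sqrt_mul zero_le_two, sech]
  have h1 : √(Real.cosh x) ^ 2 = Real.cosh x := Real.sq_sqrt hc.le
  have h2 : 0 < √(Real.cosh x) := Real.sqrt_pos.2 hc
  have h3 : (0 : ℝ) < √2 := by positivity
  field_simp
  exact h1.symm

theorem solitonEigenvector_zero (x : ℝ) : solitonEigenvector x 0 =
    -((√2 * Real.exp (-(Real.log (Real.cosh x) / 2)) : ℝ) : ℂ) * frameCos x := by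
  have : solitonEigenvector x 0 = ((-(sech x * Real.exp (-x / 2)) : ℝ) : ℂ) := by
    simp [solitonEigenvector, solitonProfile_eq]
  rw [this, ← exp_neg_half_log_cosh_div, frameCos]
  push_cast
  ring

theorem solitonEigenvector_one (x : ℝ) : solitonEigenvector x 1 =
    ((√2 * Real.exp (-(Real.log (Real.cosh x) / 2)) : ℝ) : ℂ) * frameSin x := by
  have : solitonEigenvector x 1 = ((sech x * Real.exp (x / 2) : ℝ) : ℂ) := by
    simp [solitonEigenvector, solitonProfile_eq]
  rw [this, ← exp_neg_half_log_cosh_div, frameSin]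
  push_cast
  ring

end Norms

/-! ### Comparison of the perturbed eigenvector with the soliton. -/

section Perturbation

variable {a t : ℝ → ℂ}

theorem frame_mul_conj_add (a t : ℝ → ℂ) (x : ℝ) :
    (a x * (-frameCos x + t x * frameSin x)) * conj (a x * (-frameCos x + t x * frameSin x)) +
      (a x * (frameSin x + t x * frameCos x)) * conj (a x * (frameSin x + t x * frameCos x)) =
    (a x * conj (a x)) * (1 + t x * conj (t x)) := by
  have h1 : (frameSin x : ℂ) ^ 2 + (frameCos x : ℂ) ^ 2 = 1 := by
    exact_mod_cast frameSin_sq_add_frameCos_sq x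
  simp only [map_mul, map_add, map_neg, Complex.conj_ofReal]
  linear_combination (a x * conj (a x)) * (1 + t x * conj (t x)) * h1

theorem one_add_mul_conj (z : ℂ) : 1 + z * conj z = ((1 + ‖z‖ ^ 2 : ℝ) : ℂ) := by
  rw [Complex.mul_conj']; push_cast; rfl

theorem one_add_mul_conj_ne_zero (z : ℂ) : 1 + z * conj z ≠ 0 := by
  rw [one_add_mul_conj, Complex.ofReal_ne_zero]; positivity

theorem frame_mul_conj_add_ne_zero (ha : ∀ x, a x ≠ 0) (t : ℝ → ℂ) (x : ℝ) :
    (a x * (-frameCos x + t x * frameSin x)) * conj (a x * (-frameCos x + t x * frameSin x)) +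
      (a x * (frameSin x + t x * frameCos x)) * conj (a x * (frameSin x + t x * frameCos x)) ≠ 0 := by
  rw [frame_mul_conj_add]
  exact mul_ne_zero (mul_ne_zero (ha x) ((map_ne_zero _).2 (ha x))) (one_add_mul_conj_ne_zero _)

/-- The amplitude cancels, so the quotient depends on `t` alone and equals `-c s = -sech / 2` at `t
= 0`. A pointwise bound by `‖t‖` passes directly to `L²`. -/
theorem norm_crossRatio_add_le (ha : ∀ x, a x ≠ 0) {x : ℝ} (ht : ‖t x‖ ≤ 1) :
    ‖crossRatio (fun x => a x * (-frameCos x + t x * frameSin x))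
      (fun x => a x * (frameSin x + t x * frameCos x)) x + sech x / 2‖ ≤ 2 * ‖t x‖ := by
  have ha0 : a x * conj (a x) ≠ 0 := mul_ne_zero (ha x) ((map_ne_zero _).2 (ha x))
  have e : crossRatio (fun x => a x * (-frameCos x + t x * frameSin x))
      (fun x => a x * (frameSin x + t x * frameCos x)) x + sech x / 2 =
      ((t x * (frameSin x : ℂ) ^ 2 - conj (t x) * (frameCos x : ℂ) ^ 2) +
        t x * conj (t x) * sech x) / (1 + t x * conj (t x)) := by
    rw [crossRatio, frame_mul_conj_add, eq_div_iff (one_add_mul_conj_ne_zero _),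
      ofReal_sech_eq_frame, add_mul, mul_inv, mul_assoc _ _ (1 + t x * conj (t x)),
      mul_assoc _ _ (1 + t x * conj (t x)), inv_mul_cancel₀ (one_add_mul_conj_ne_zero _), mul_one]
    simp only [map_mul, map_add, Complex.conj_ofReal]
    rw [← div_eq_mul_inv, div_add' _ _ _ ha0, div_eq_iff ha0]
    ring
  rw [e, norm_div, one_add_mul_conj, Complex.norm_real, Real.norm_of_nonneg (by positivity)]
  have h0 := norm_nonneg (t x)
  refine (div_le_self (norm_nonneg _) (by nlinarith)).trans ?_
  refine (norm_add_le _ _).trans ?_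
  have h2 : ‖t x * (frameSin x : ℂ) ^ 2 - conj (t x) * (frameCos x : ℂ) ^ 2‖ ≤ ‖t x‖ := by
    refine (norm_sub_le _ _).trans ?_
    rw [norm_mul, norm_mul, RCLike.norm_conj, norm_pow, norm_pow, Complex.norm_real,
      Complex.norm_real, ← mul_add, Real.norm_eq_abs, Real.norm_eq_abs, sq_abs, sq_abs,
      frameSin_sq_add_frameCos_sq, mul_one]
  have h3 : ‖t x * conj (t x) * sech x‖ ≤ ‖t x‖ := by
    rw [norm_mul, norm_mul, RCLike.norm_conj, Complex.norm_real,
      Real.norm_of_nonneg (sech_pos x).le]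
    calc ‖t x‖ * ‖t x‖ * sech x ≤ ‖t x‖ * 1 * 1 := by
          gcongr
          · exact (sech_pos x).le
          · exact sech_le_one x
      _ = ‖t x‖ := by ring
  linarith

theorem abs_frameCos_le_one (x : ℝ) : |frameCos x| ≤ 1 :=
  abs_le_one_iff_mul_self_le_one.2 (by
    nlinarith [sq_nonneg (frameSin x), frameSin_sq_add_frameCos_sq x])

theorem abs_frameSin_le_one (x : ℝ) : |frameSin x| ≤ 1 :=
  abs_le_one_iff_mul_self_le_one.2 (by
    nlinarith [sq_nonneg (frameCos x), frameSin_sq_add_frameCos_sq x])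

theorem norm_frame_fst_le {x : ℝ} (ht : ‖t x‖ ≤ 1) :
    ‖(-frameCos x + t x * frameSin x : ℂ)‖ ≤ 2 := by
  have hc := abs_frameCos_le_one x
  have hs := abs_frameSin_le_one x
  refine (norm_add_le _ _).trans ?_
  rw [norm_neg, norm_mul, Complex.norm_real, Complex.norm_real, Real.norm_eq_abs, Real.norm_eq_abs]
  have := mul_le_mul ht hs (abs_nonneg _) zero_le_one
  linarith

theorem norm_frame_snd_le {x : ℝ} (ht : ‖t x‖ ≤ 1) :
    ‖(frameSin x + t x * frameCos x : ℂ)‖ ≤ 2 := by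
  have hc := abs_frameCos_le_one x
  have hs := abs_frameSin_le_one x
  refine (norm_add_le _ _).trans ?_
  rw [norm_mul, Complex.norm_real, Complex.norm_real, Real.norm_eq_abs, Real.norm_eq_abs]
  have := mul_le_mul ht hc (abs_nonneg _) zero_le_one
  linarith

theorem norm_frame_sub_solitonEigenvector_le {x B K T : ℝ} (hT : 0 ≤ T) (ht : ‖t x‖ ≤ T)
    (hB : ‖a x‖ ≤ B)
    (hK : ‖a x - (√2 * Real.exp (-(Real.log (Real.cosh x) / 2)) : ℝ)‖ ≤ K) :
    ‖![a x * (-frameCos x + t x * frameSin x), a x * (frameSin x + t x * frameCos x)] -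
      solitonEigenvector x‖ ≤ K + B * T := by
  have hc := abs_frameCos_le_one x
  have hs := abs_frameSin_le_one x
  have hB0 := (norm_nonneg _).trans hB
  have hK0 := (norm_nonneg _).trans hK
  refine (pi_norm_le_iff_of_nonneg (by positivity)).2 fun i => ?_
  set b : ℂ := ((√2 * Real.exp (-(Real.log (Real.cosh x) / 2)) : ℝ) : ℂ) with hb
  have key : ∀ u v : ℝ, |u| ≤ 1 → |v| ≤ 1 → ‖(a x - b) * u + a x * t x * v‖ ≤ K + B * T := by
    intro u v hu hv
    refine (norm_add_le _ _).trans ?_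
    rw [norm_mul, norm_mul, norm_mul, Complex.norm_real, Complex.norm_real, Real.norm_eq_abs,
      Real.norm_eq_abs]
    calc _ ≤ K * 1 + B * T * 1 := by gcongr
      _ = _ := by ring
  fin_cases i
  · simp only [Pi.sub_apply, Fin.zero_eta, Matrix.cons_val_zero, solitonEigenvector_zero]
    refine le_of_eq_of_le (congrArg _ ?_) (key (-frameCos x) (frameSin x) (by rwa [abs_neg]) hs)
    rw [← hb]; push_cast; ring
  · simp only [Pi.sub_apply, Fin.mk_one, Matrix.cons_val_one, Matrix.cons_val_fin_one,
      solitonEigenvector_one]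
    refine le_of_eq_of_le (congrArg _ ?_) (key (frameSin x) (frameCos x) hs hc)
    rw [← hb]; ring

theorem memLp_exp_neg_abs_div_four (B : ℝ) : MemLp (fun x : ℝ => B * Real.exp (-|x| / 4)) 2 := by
  refine MemLp.const_mul ?_ B
  rw [memLp_two_iff_integrable_sq (by fun_prop)]
  refine (integrable_exp_neg_mul_abs_sub (a := 1 / 2) (by norm_num) 0).congr
    (Eventually.of_forall fun y => ?_)
  simp only
  rw [← Real.exp_nat_mul, zero_sub, abs_neg]
  congr 1; push_cast; ring

theorem IsLaxSolution.isLaxEigenvector {η : ℂ} {Q ψ₁ ψ₂ : ℝ → ℂ} {B : ℝ} (hQ : MemLp Q 2)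
    (h : IsLaxSolution η Q ψ₁ ψ₂) (hη : ‖η‖ ≤ 1)
    (h1 : ∀ x, ‖ψ₁ x‖ ≤ B * Real.exp (-|x| / 4)) (h2 : ∀ x, ‖ψ₂ x‖ ≤ B * Real.exp (-|x| / 4))
    (hN : ∀ x, ψ₁ x * conj (ψ₁ x) + ψ₂ x * conj (ψ₂ x) ≠ 0) :
    IsLaxEigenvector η Q fun x => ![ψ₁ x, ψ₂ x] := by
  have hd := h.hasACDeriv
  have hB : 0 ≤ B := nonneg_of_mul_nonneg_left ((norm_nonneg _).trans (h1 0)) (Real.exp_pos _)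
  have hle : ∀ x, B * Real.exp (-|x| / 4) ≤ B := fun x =>
    mul_le_of_le_one_right hB (Real.exp_le_one_iff.2 (by linarith [abs_nonneg x]))
  have hΨ : MemLp (fun x => ![ψ₁ x, ψ₂ x]) 2 := by
    refine (memLp_exp_neg_abs_div_four B).mono' hd.continuous.aestronglyMeasurable
      (Eventually.of_forall fun x => ?_)
    refine (pi_norm_le_iff_of_nonneg (by positivity)).2 fun i => ?_
    fin_cases i
    · exact h1 x
    · exact h2 x
  refine ⟨⟨hΨ, _, hd.hasWeakDeriv, ?_⟩, fun h0 => ?_, hd.hasWeakDeriv⟩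
  · refine ((memLp_exp_neg_abs_div_four B).add (hQ.norm.const_mul B)).mono'
      hd.locallyIntegrable.aestronglyMeasurable (Eventually.of_forall fun x => ?_)
    simp only [Pi.add_apply]
    have a1 := h1 x
    have a2 := h2 x
    have a3 := hle x
    refine (pi_norm_le_iff_of_nonneg (by positivity)).2 fun i => ?_
    fin_cases i
    · simp only [Fin.zero_eta, laxMatrix_mulVec_zero, Matrix.cons_val_zero, Matrix.cons_val_one]
      refine (norm_add_le _ _).trans ?_
      rw [norm_mul, norm_mul]
      calc ‖η‖ * ‖ψ₁ x‖ + ‖Q x‖ * ‖ψ₂ x‖ ≤ 1 * (B * Real.exp (-|x| / 4)) + ‖Q x‖ * B := by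
            gcongr; linarith
        _ = _ := by ring
    · simp only [Fin.mk_one, laxMatrix_mulVec_one, Matrix.cons_val_zero, Matrix.cons_val_one]
      refine (norm_sub_le _ _).trans ?_
      rw [norm_mul, norm_mul, norm_neg, RCLike.norm_conj]
      calc ‖Q x‖ * ‖ψ₁ x‖ + ‖η‖ * ‖ψ₂ x‖ ≤ ‖Q x‖ * B + 1 * (B * Real.exp (-|x| / 4)) := by
            gcongr; linarith
        _ = _ := by ring
  · obtain ⟨x, hx⟩ := h0.exists
    have e1 : ψ₁ x = 0 := congrFun hx 0
    have e2 : ψ₂ x = 0 := congrFun hx 1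
    exact hN x (by rw [e1, e2]; simp)

end Perturbation

end

/-! ### Assembly of the main theorem. -/

theorem mainTheorem3 :
    ∃ C ε : ℝ≥0, 0 < C ∧ 0 < ε ∧
      ∀ Q : ℝ → ℂ, MemLp Q 2 volume →
        eLpNorm (Q - solitonProfile) 2 volume ≤ ε →
        ∃ k v : ℝ,
          (∃ Ψ : ℝ → Fin 2 → ℂ,
            IsLaxEigenvector (((k : ℂ) + Complex.I * v) / 2) Q Ψ ∧
            ‖k - 1‖ₑ + ‖v‖ₑ + eLpNorm (Ψ - solitonEigenvector) ∞ volume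
              ≤ C * eLpNorm (Q - solitonProfile) 2 volume) ∧
          (MemH 3 Q →
            ∀ Ψ : ℝ → Fin 2 → ℂ,
              IsLaxEigenvector (((k : ℂ) + Complex.I * v) / 2) Q Ψ →
              (∀ᵐ x, Ψ x ≠ 0) ∧
              MemH 3 (backlundTransform k Q Ψ) ∧
              eLpNorm (backlundTransform k Q Ψ) 2 volume
                ≤ C * eLpNorm (Q - solitonProfile) 2 volume) := by
  -- The first claim needs `4 + 4 + 180 = 188`; the second needs the square root of `3 + 48 · 4 + 75
  -- · 304 = 22995`, below `152`. The threshold `1/200` is that of the fixed-point argument.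
  refine ⟨200, 1 / 200, by norm_num, by norm_num, fun Q hQ hε => ?_⟩
  have hp : MemLp (Q - solitonProfile) 2 := hQ.sub memLp_solitonProfile
  set p : ℝ → ℂ := Q - solitonProfile with hpdef
  have hQp : ∀ x, Q x = sech x + p x := fun x => by
    rw [hpdef, Pi.sub_apply, solitonProfile_eq]; ring
  set δ : ℝ := √(∫ x, ‖p x‖ ^ 2) with hδdef
  have hδ0 : 0 ≤ δ := Real.sqrt_nonneg _
  have hδ : ∫ x, ‖p x‖ ^ 2 ≤ δ ^ 2 :=
    (Real.sq_sqrt (integral_nonneg fun x => by positivity)).ge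
  have hnorm : eLpNorm p 2 volume = ENNReal.ofReal δ := eLpNorm_two_eq hp
  have hδ1 : δ ≤ 1 / 200 := by
    rw [hnorm, ENNReal.ofReal_le_iff_le_toReal ENNReal.coe_ne_top] at hε
    simpa using hε
  have hC : ((200 : ℝ≥0) : ℝ≥0∞) * eLpNorm p 2 volume = ENNReal.ofReal (200 * δ) := by
    rw [hnorm, ENNReal.ofReal_mul (by norm_num)]
    norm_num
  rw [hC]
  obtain ⟨t, μ, ht, hμ, hd⟩ := exists_riccati_solution hp hδ0 hδ1 hδ
  obtain ⟨hti, htl⟩ := riccati_sq_integrable hp hδ0 hδ1 hδ ht hμ hd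
  obtain ⟨hhi, hhl⟩ := amplitudeRate_integrable hp hδ0 hδ1 hδ ht hμ hd.continuous hti htl
  have ht1 : ∀ x, ‖t x‖ ≤ 1 := fun x => (ht x).trans (by linarith)
  set a : ℝ → ℂ := amplitude p t μ with ha
  have ha0 : ∀ x, a x ≠ 0 := amplitude_ne_zero
  have hab : ∀ x, ‖a x‖ ≤ 6 * Real.exp (-|x| / 4) := norm_amplitude_le hδ1 hμ hhi hhl
  have hab' : ∀ x, ‖a x‖ ≤ 6 := fun x => (hab x).trans
    (mul_le_of_le_one_right (by norm_num) (Real.exp_le_one_iff.2 (by linarith [abs_nonneg x])))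
  set ψ₁ : ℝ → ℂ := fun x => a x * (-frameCos x + t x * frameSin x) with hψ₁
  set ψ₂ : ℝ → ℂ := fun x => a x * (frameSin x + t x * frameCos x) with hψ₂
  have hN : ∀ x, ψ₁ x * conj (ψ₁ x) + ψ₂ x * conj (ψ₂ x) ≠ 0 := frame_mul_conj_add_ne_zero ha0 t
  have hre := abs_le.1 ((Complex.abs_re_le_norm μ).trans hμ)
  have him := (Complex.abs_im_le_norm μ).trans hμ
  -- This choice makes `η = (k + iv) / 2` equal to `1/2 + μ`.
  refine ⟨1 + 2 * μ.re, 2 * μ.im, ?_⟩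
  have hη : (((1 + 2 * μ.re : ℝ) : ℂ) + Complex.I * ((2 * μ.im : ℝ) : ℂ)) / 2 = 1 / 2 + μ := by
    apply Complex.ext <;> simp
    ring
  rw [hη]
  have hsol : IsLaxSolution (1 / 2 + μ) Q ψ₁ ψ₂ := by
    refine ⟨(hasACDeriv_eigenvector_fst hhi hd).of_eq_deriv fun x => ?_,
      (hasACDeriv_eigenvector_snd hhi hd).of_eq_deriv fun x => ?_⟩
    · rw [hQp x]
    · rw [hQp x, map_add, Complex.conj_ofReal]
  have hη1 : ‖1 / 2 + μ‖ ≤ 1 := by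
    refine (norm_add_le _ _).trans ?_
    norm_num
    linarith
  have hψ₁b : ∀ x, ‖ψ₁ x‖ ≤ 12 * Real.exp (-|x| / 4) := fun x => by
    rw [hψ₁, norm_mul]
    have := mul_le_mul (hab x) (norm_frame_fst_le (ht1 x)) (norm_nonneg _) (by positivity)
    linarith
  have hψ₂b : ∀ x, ‖ψ₂ x‖ ≤ 12 * Real.exp (-|x| / 4) := fun x => by
    rw [hψ₂, norm_mul]
    have := mul_le_mul (hab x) (norm_frame_snd_le (ht1 x)) (norm_nonneg _) (by positivity)
    linarith
  have heig := hsol.isLaxEigenvector hQ hη1 hψ₁b hψ₂b hN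
  refine ⟨⟨fun x => ![ψ₁ x, ψ₂ x], heig, ?_⟩, ?_⟩
  · have e1 : ‖1 + 2 * μ.re - 1‖ₑ ≤ ENNReal.ofReal (4 * δ) := by
      rw [← ofReal_norm]
      refine ENNReal.ofReal_le_ofReal ?_
      rw [Real.norm_eq_abs, abs_le]
      constructor <;> linarith [hre.1, hre.2]
    have e2 : ‖2 * μ.im‖ₑ ≤ ENNReal.ofReal (4 * δ) := by
      rw [← ofReal_norm]
      refine ENNReal.ofReal_le_ofReal ?_
      rw [norm_mul, Real.norm_eq_abs, Real.norm_eq_abs, abs_two]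
      linarith
    -- Here `180 = 168 + 6 · 2`: the amplitude error plus the amplitude bound times the bound on
    -- `t`.
    have e3 : eLpNorm ((fun x => ![ψ₁ x, ψ₂ x]) - solitonEigenvector) ∞ volume ≤
        ENNReal.ofReal (180 * δ) := by
      rw [eLpNorm_exponent_top]
      refine eLpNormEssSup_le_of_ae_bound (Eventually.of_forall fun x => ?_)
      refine (norm_frame_sub_solitonEigenvector_le (by positivity) (ht x) (hab' x)
        (norm_amplitude_sub_le hδ0 hδ1 hμ hhi hhl x)).trans ?_
      linarith
    refine (add_le_add (add_le_add e1 e2) e3).trans ?_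
    rw [← ENNReal.ofReal_add (by positivity) (by positivity),
      ← ENNReal.ofReal_add (by positivity) (by positivity)]
    exact ENNReal.ofReal_le_ofReal (by linarith)
  · intro hQ3 Φ hΦ
    obtain ⟨F, hF, hFs, hF0, hF1⟩ := hΦ.exists_isLaxSolution
    have hmem₁ : MemLp ψ₁ 2 := (memLp_exp_neg_abs_div_four 12).mono'
      hsol.fst.continuous.aestronglyMeasurable (Eventually.of_forall hψ₁b)
    have hmem₂ : MemLp ψ₂ 2 := (memLp_exp_neg_abs_div_four 12).mono'
      hsol.snd.continuous.aestronglyMeasurable (Eventually.of_forall hψ₂b)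
    obtain ⟨l, hl⟩ := hsol.exists_eq_mul hFs hN
      (hsol.wronskian_eq_zero hFs hmem₁ hmem₂ hF0 hF1)
    have hl0 : l ≠ 0 := by
      rintro rfl
      refine hΦ.ne_zero (hF.trans (Eventually.of_forall fun x => ?_))
      ext i
      fin_cases i
      · simpa using (hl x).1
      · simpa using (hl x).2
    have hback : backlundTransform (1 + 2 * μ.re) Q (fun x => ![ψ₁ x, ψ₂ x]) =ᵐ[volume]
        backlundTransform (1 + 2 * μ.re) Q Φ := by
      filter_upwards [hF] with x hx
      refine (backlundTransform_smul hl0 _ Q ?_ ?_).symm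
      · rw [hx]; exact (hl x).1
      · rw [hx]; exact (hl x).2
    set q : ℝ → ℂ := backlundTransform (1 + 2 * μ.re) Q (fun x => ![ψ₁ x, ψ₂ x]) with hq
    have ht2 : MemLp t 2 :=
      (memLp_two_iff_integrable_sq_norm hd.continuous.aestronglyMeasurable).2 hti
    have hcont : Continuous (crossRatio ψ₁ ψ₂) := (hsol.hasACDeriv_crossRatio hN).continuous
    have hcr : ∀ x, ‖crossRatio ψ₁ ψ₂ x + sech x / 2‖ ≤ 2 * ‖t x‖ := fun x =>
      norm_crossRatio_add_le ha0 (ht1 x)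
    have hsech2 : MemLp (fun x => (sech x : ℂ) / 2) 2 := by
      have := memLp_solitonProfile.const_mul (1 / 2 : ℂ)
      refine this.ae_eq (Eventually.of_forall fun x => ?_)
      rw [solitonProfile_eq]; ring
    have hP : MemLp (crossRatio ψ₁ ψ₂) 2 := by
      have hsum : MemLp (fun x => crossRatio ψ₁ ψ₂ x + sech x / 2) 2 :=
        (ht2.norm.const_mul 2).mono' (hcont.aestronglyMeasurable.add hsech2.1)
          (Eventually.of_forall hcr)
      refine (hsum.sub hsech2).ae_eq (Eventually.of_forall fun x => ?_)
      simp
    have hqH : MemH 3 q := by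
      -- `H²` regularity of `Q` is enough here, because the quotient gains a derivative.
      have hP3 : MemH 3 (crossRatio ψ₁ ψ₂) := hsol.memH_crossRatio hN hP hQ3.of_succ
      refine ((hQ3.const_mul (-1)).add
        (hP3.const_mul (-(2 * ((1 + 2 * μ.re : ℝ) : ℂ))))).congr (Eventually.of_forall fun x => ?_)
      exact (backlundTransform_eq _ _ _ _ _).symm
    refine ⟨?_, hqH.congr hback, ?_⟩
    · filter_upwards [hF] with x hx h0
      rw [hx] at h0
      have f0 : l * ψ₁ x = 0 := by rw [← (hl x).1, h0]; rfl
      have f1 : l * ψ₂ x = 0 := by rw [← (hl x).2, h0]; rfl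
      refine hN x ?_
      rw [(mul_eq_zero.1 f0).resolve_left hl0, (mul_eq_zero.1 f1).resolve_left hl0]
      simp
    · rw [← eLpNorm_congr_ae hback]
      refine eLpNorm_two_le hqH.memLp (by positivity) ?_
      have hqb : ∀ x, ‖q x‖ ≤ ‖p x‖ + 4 * δ * sech x + 5 * ‖t x‖ := fun x => by
        -- For the soliton `-Q - 2P` vanishes identically; what remains is `-p`, the shift `k - 1 =
        -- 2 Re μ`, and the deviation of `P`.
        have e : q x = -p x + ((2 * μ.re : ℝ) : ℂ) * sech x +
            -((2 * (1 + 2 * μ.re) : ℝ) : ℂ) * (crossRatio ψ₁ ψ₂ x + sech x / 2) := by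
          rw [hq, backlundTransform_eq, hQp x]; push_cast; ring
        rw [e]
        refine norm_add₃_le.trans ?_
        rw [norm_neg, norm_mul, norm_mul, norm_neg, Complex.norm_real, Complex.norm_real,
          Complex.norm_real, Real.norm_of_nonneg (sech_pos x).le,
          Real.norm_of_nonneg (show 0 ≤ 2 * (1 + 2 * μ.re) by linarith [hre.1])]
        have b1 : ‖2 * μ.re‖ ≤ 4 * δ := by
          rw [Real.norm_eq_abs, abs_le]
          constructor <;> linarith [hre.1, hre.2]
        have b2 : 2 * (1 + 2 * μ.re) * ‖crossRatio ψ₁ ψ₂ x + sech x / 2‖ ≤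
            5 / 2 * (2 * ‖t x‖) := by
          gcongr
          · linarith [hre.2]
          · exact hcr x
        have b3 := mul_le_mul_of_nonneg_right b1 (sech_pos x).le
        linarith
      have hp2 : Integrable fun x => ‖p x‖ ^ 2 := hp.norm.integrable_sq
      have i2 := integrable_sech_sq.const_mul (48 * δ ^ 2)
      have i3 : Integrable fun x => 3 * ‖p x‖ ^ 2 + 48 * δ ^ 2 * sech x ^ 2 :=
        (hp2.const_mul 3).add i2
      have hle : ∫ x, ‖q x‖ ^ 2 ≤
          ∫ x, (3 * ‖p x‖ ^ 2 + 48 * δ ^ 2 * sech x ^ 2 + 75 * ‖t x‖ ^ 2) := by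
        refine integral_mono hqH.memLp.norm.integrable_sq
          (i3.add (hti.const_mul 75)) fun x => ?_
        have := hqb x
        have s0 := sech_pos x
        calc ‖q x‖ ^ 2 ≤ (‖p x‖ + 4 * δ * sech x + 5 * ‖t x‖) ^ 2 := by gcongr
          _ ≤ _ := by
            nlinarith [sq_nonneg (‖p x‖ - 4 * δ * sech x), sq_nonneg (‖p x‖ - 5 * ‖t x‖),
              sq_nonneg (4 * δ * sech x - 5 * ‖t x‖)]
      refine hle.trans ?_
      rw [integral_add i3 (hti.const_mul 75),
        integral_add (hp2.const_mul 3) i2, integral_const_mul, integral_const_mul,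
        integral_const_mul]
      nlinarith [mul_le_mul_of_nonneg_left integral_sech_sq_le (sq_nonneg δ)]
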